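/- **Setting.** Let $(\mathsf X,\mathcal X)$ and $(\Theta,\mathcal T)$ be measurable spaces and $\{P_\theta,\theta\in\Theta\}$ a family of Markov transition kernels on $\mathsf X$, jointly measurable in $(\theta,x)$. Let $\{(X_n,\theta_n),n\ge 0\}$ be an $\mathsf X\times\Theta$-valued process adapted to a filtration $\{\mathcal F_n\}$ on a probability space $(\Omega,\mathcal A,\mathbb P)$ such that $\mathbb E[f(X_{n+1})\mid\mathcal F_n]=P_{\theta_n}f(X_n)$ a.s. for every $n$ and every bounded measurable $f$. Let $V:\mathsf X\to[1,\infty)$ be measurable. For $f:\mathsf X\to\mathbb R$, probability measures $\mu_1,\mu_2$ on $\mathsf X$ and $\theta,\theta'\in\Theta$ put $$\|f\|_V=\sup_x\frac{|f(x)|}{V(x)},\qquad \|\mu_1-\mu_2\|_V=\sup_{\|f\|_V\le 1}|\mu_1(f)-\mu_2(f)|,\qquad D_V(\theta,\theta')=\sup_x\frac{\|P_\theta(x,\cdot)-P_{\theta'}(x,\cdot)\|_V}{V(x)},$$ where $f$ in the second supremum is measurable and integrable for $\mu_1$ and $\mu_2$. **(A3)** For every $\theta\in\Theta$, the kernel $P_\theta$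 is irreducible (with respect to some probability measure) and aperiodic, and there are constants $b_\theta<\infty$, $\delta_\theta\in(0,1)$, $\lambda_\theta\in(0,1)$ and a probability measure $\nu_\theta$ on $\mathsf X$ such that, with $c_\theta=2b_\theta(1-\lambda_\theta)^{-1}-1$, $$P_\theta V\le\lambda_\theta V+b_\theta,\qquad P_\theta(x,\cdot)\ge\delta_\theta\,\nu_\theta(\cdot)\,\mathbf 1_{\{V\le c_\theta\}}(x).$$ Let $\pi_\theta$ be the (unique) invariant probability measure of $P_\theta$, and let $L_\theta\in[1,\infty]$ be the infimum of $C\vee(1-\rho)^{-1}$ over all finite $C\ge 0$ and $\rho\in(0,1)$ such that $\|P_\theta^n(x,\cdot)-\pi_\theta\|_V\le C\rho^n V(x)$ for all $n\ge0$, $x\in\mathsf X$ (if there are no such $\pi_\theta$, $C$, $\rho$, then $L_\theta=\infty$; condition (A5)(b) below excludes this along $\{\theta_n\}$ almost surely). **(A4)** $\displaystyle\sum_{k\ge1}k^{-1}\,(L_{\theta_k}\vee L_{\theta_{k-1}})^6\,D_V(\theta_k,\theta_{k-1})\,V(X_k)<\infty$ a.s. **(A5)** (a) $\limsup_n\pi_{\theta_n}(V)<\infty$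 a.s.; (b) for some $\alpha>1$, $\displaystyle\sum_{k\ge0}(k+1)^{-\alpha}L_{\theta_k}^{2\alpha}\,P_{\theta_k}V^\alpha(X_k)<\infty$ a.s. **Theorem.** Assume (A3), (A4) and (A5). Let $F:\mathsf X\times\Theta\to\mathbb R$ be a measurable function such that 1. $\sup_\theta\|F(\cdot,\theta)\|_V<\infty$; 2. $\sum_{k\ge1}k^{-1}L_{\theta_{k-1}}^2\,\|F(\cdot,\theta_k)-F(\cdot,\theta_{k-1})\|_V\,V(X_k)<\infty$ a.s.; 3. $\lim_{n\to\infty}\int\pi_{\theta_n}(dx)\,F(x,\theta_n)$ exists a.s. Then, almost surely, $$\lim_{n\to\infty}\frac1n\sum_{k=0}^{n-1}F(X_k,\theta_k)=\lim_{n\to\infty}\int\pi_{\theta_n}(dx)\,F(x,\theta_n).$$ -/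

import Mathlib

open MeasureTheory ProbabilityTheory Filter Topology
open scoped ENNReal

namespace AdaptiveMCMC

/-- The `V`-norm `sup_x |f x| / V x`, with values in `[0, ∞]`. -/
noncomputable def vNorm {X : Type*} (V : X → ℝ) (f : X → ℝ) : ℝ≥0∞ :=
  ⨆ x, ENNReal.ofReal (|f x| / V x)

/-- The `V`-distance `sup {|μ₁ f - μ₂ f| : ‖f‖_V ≤ 1}`, with values in `[0, ∞]`. The supremum runs
over the measurable `f` for which both integrals make sense; if `V` is integrable for `μ₁` and
`μ₂`, these are all measurable `f` with `‖f‖_V ≤ 1`. -/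
noncomputable def vDist {X : Type*} [MeasurableSpace X] (V : X → ℝ) (μ₁ μ₂ : Measure X) : ℝ≥0∞ :=
  ⨆ (f : X → ℝ) (_ : Measurable f ∧ vNorm V f ≤ 1 ∧ Integrable f μ₁ ∧ Integrable f μ₂),
    ENNReal.ofReal |∫ x, f x ∂μ₁ - ∫ x, f x ∂μ₂|

/-- The `V`-variation `sup_x ‖κ(x, ·) - η(x, ·)‖_V / V x` of two kernels. -/
noncomputable def kernelVariation {X : Type*} [MeasurableSpace X] (V : X → ℝ) (κ η : Kernel X X) :
    ℝ≥0∞ :=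
  ⨆ x, vDist V (κ x) (η x) / ENNReal.ofReal (V x)

/-- A `φ`-irreducible kernel is aperiodic if there is no cycle `D 0 → D 1 → ⋯ → D (d-1) → D 0` of
`d ≥ 2` disjoint measurable sets that cover the space up to a `φ`-null set. -/
def IsAperiodic {X : Type*} [MeasurableSpace X] (φ : Measure X) (κ : Kernel X X) : Prop :=
  ¬ ∃ (d : ℕ) (D : ZMod d → Set X), 2 ≤ d ∧ (∀ i, MeasurableSet (D i)) ∧
    Pairwise (fun i j => Disjoint (D i) (D j)) ∧
    (∀ i, ∀ x ∈ D i, κ x (D (i + 1)) = 1) ∧ φ (⋃ i, D i)ᶜ = 0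

/-- Geometric drift `κ V ≤ lam V + b` and minorization `κ(x, ·) ≥ δ ν` on the level set
`{V ≤ 2 b / (1 - lam) - 1}`, for an irreducible and aperiodic kernel. -/
def GeometricDriftMinorization {X : Type*} [MeasurableSpace X] (V : X → ℝ) (κ : Kernel X X) :
    Prop :=
  (∃ φ : Measure X, IsProbabilityMeasure φ ∧ Kernel.IsIrreducible φ κ ∧ IsAperiodic φ κ) ∧
  ∃ (b δ lam : ℝ) (ν : Measure X), δ ∈ Set.Ioo (0 : ℝ) 1 ∧ lam ∈ Set.Ioo (0 : ℝ) 1 ∧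
    IsProbabilityMeasure ν ∧
    (∀ x, ∫⁻ y, ENNReal.ofReal (V y) ∂(κ x) ≤ ENNReal.ofReal (lam * V x + b)) ∧
    (∀ x, V x ≤ 2 * b * (1 - lam)⁻¹ - 1 →
      ∀ A, MeasurableSet A → ENNReal.ofReal δ * ν A ≤ κ x A)

open Classical in
/-- The invariant probability measure of `κ` (the zero measure if there is none). It is unique for
irreducible `κ`. -/
noncomputable def invariantProb {X : Type*} [MeasurableSpace X] (κ : Kernel X X) : Measure X :=
  if h : ∃ μ : Measure X, IsProbabilityMeasure μ ∧ Kernel.Invariant κ μ then h.choose else 0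

/-- `C` and `ρ` are constants of geometric ergodicity of `κ`:
`‖κ^n(x, ·) - π‖_V ≤ C ρ^n V x` for all `n` and `x`, `π` the invariant probability measure. -/
def IsErgodicityConst {X : Type*} [MeasurableSpace X] (V : X → ℝ) (κ : Kernel X X) (C ρ : ℝ) :
    Prop :=
  0 ≤ C ∧ ρ ∈ Set.Ioo (0 : ℝ) 1 ∧
    ∀ (n : ℕ) (x : X), vDist V ((κ ^ n) x) (invariantProb κ) ≤ ENNReal.ofReal (C * ρ ^ n * V x)

/-- The number `L = C ∨ (1 - ρ)⁻¹`, taken smallest possible: the infimum over all constants of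
geometric ergodicity `C`, `ρ` (`∞` if there are none). Every other choice of the constants gives a
larger `L`, hence stronger summability conditions on `L`. -/
noncomputable def ergodicityL {X : Type*} [MeasurableSpace X] (V : X → ℝ) (κ : Kernel X X) :
    ℝ≥0∞ :=
  ⨅ (C : ℝ) (ρ : ℝ) (_ : IsErgodicityConst V κ C ρ), ENNReal.ofReal (max C (1 - ρ)⁻¹)

end AdaptiveMCMC

/-! Let `H_θ` be the Poisson solution for a function `g` and the kernel `P_θ`. Then `g - π_θ g = H_θ
- P_θ H_θ`, so the centred sum along the chain splits into martingale differences, a telescoping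
part, and the changes of `H_θ` in `θ`. Geometric ergodicity gives `|H_θ| ≤ const · L_θ² V`, and
`abs_poisson_sub_poisson_le` gives a Lipschitz bound in the kernel. Hence (A4) and the condition on
the variation of `F` make the changes summable after division by `k`, and (A5)(b) controls the
`α`-th moments of the differences.

For `α ≤ 2` a classical martingale law of large numbers would finish. For `α > 2` it is not
available: independent centred Gaussians of variance `k` satisfy `∑ k^{-α} E|ξ_k|^α < ∞`, but their
averages do not tend to zero. The missing ingredient is positivity. Since `|F| ≤ K V`, it suffices
to treat the nonnegative functions `F + K V` and `K V` and subtract.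

For `g ≥ 0` the running average `a_k` is followed through a convex function `Φ` that vanishes on
`(-∞, η]` and has slope `ψ = clampAbove η ^ r`. The dangerous second-order error is at most `c ψ v_k
/ k` plus summable terms, where `v_k ≥ 0` is the new value of `g`. Because `v_k` is its own absolute
value, `ψ v_k / k` can be rewritten by the recursion for `a_k` and absorbed into the change of `Φ`
and the pull of `a_k` towards zero (`exists_lyapunov_step`). A large power `r` makes the remaining
errors of order `U^{r+1}` with `r + 1 ≥ α`, hence summable.

Summing, the weighted martingale is bounded below because `Φ ≥ 0`, and a martingale bounded below
with such moments converges (`ae_exists_tendsto_of_bddBelow`). Then `∑ ψ(a_k) / k` converges, and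
divergence of the harmonic series forces `a_k < 2η` eventually. The signs `σ = ±1` and `η → 0` give
`a_k → 0`. -/

namespace AdaptiveMCMC

set_option linter.unusedSectionVars false

/-! ### Consequences of geometric ergodicity: integrability of `V` and the invariant measure. -/

section Poisson

variable {X : Type*} [MeasurableSpace X] {V : X → ℝ} {κ η : Kernel X X} {C ρ C' ρ' : ℝ}

lemma integrable_of_abs_le_mul {ν : Measure X} {f : X → ℝ} {M : ℝ} (hV : Integrable V ν)
    (hf : Measurable f) (hfV : ∀ y, |f y| ≤ M * V y) : Integrable f ν :=
  (hV.const_mul M).mono' hf.aestronglyMeasurable (Eventually.of_forall hfV)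

lemma vNorm_le_one {f : X → ℝ} (hV : ∀ y, 1 ≤ V y) (hf : ∀ y, |f y| ≤ V y) : vNorm V f ≤ 1 := by
  refine iSup_le fun y => ?_
  rw [ENNReal.ofReal_le_one, div_le_one (by linarith [hV y])]
  exact hf y

lemma abs_le_of_vNorm_le {f : X → ℝ} {M : ℝ} (hM : 0 ≤ M) (hV : ∀ y, 1 ≤ V y)
    (hf : vNorm V f ≤ ENNReal.ofReal M) (y : X) : |f y| ≤ M * V y := by
  have h := (le_iSup (fun y => ENNReal.ofReal (|f y| / V y)) y).trans hf
  rw [ENNReal.ofReal_le_ofReal_iff hM, div_le_iff₀ (by linarith [hV y])] at h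
  exact h

lemma ofReal_abs_integral_sub_le {μ₁ μ₂ : Measure X} {f : X → ℝ} {M : ℝ} (hV : ∀ y, 1 ≤ V y)
    (hM : 0 ≤ M) (hf : Measurable f) (hfV : ∀ y, |f y| ≤ M * V y) (h₁ : Integrable f μ₁)
    (h₂ : Integrable f μ₂) :
    ENNReal.ofReal |∫ y, f y ∂μ₁ - ∫ y, f y ∂μ₂| ≤ ENNReal.ofReal M * vDist V μ₁ μ₂ := by
  rcases hM.eq_or_lt with rfl | hM
  · have : f = fun _ => 0 := funext fun y => by simpa using hfV y
    simp [this]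
  · have key : ENNReal.ofReal |∫ y, M⁻¹ * f y ∂μ₁ - ∫ y, M⁻¹ * f y ∂μ₂| ≤ vDist V μ₁ μ₂ := by
      refine le_iSup₂_of_le (fun y => M⁻¹ * f y)
        ⟨hf.const_mul _, vNorm_le_one hV fun y => ?_, h₁.const_mul _, h₂.const_mul _⟩ le_rfl
      rw [abs_mul, abs_of_pos (inv_pos.2 hM), inv_mul_le_iff₀ hM]
      exact hfV y
    calc ENNReal.ofReal |∫ y, f y ∂μ₁ - ∫ y, f y ∂μ₂|
        = ENNReal.ofReal M * ENNReal.ofReal |∫ y, M⁻¹ * f y ∂μ₁ - ∫ y, M⁻¹ * f y ∂μ₂| := by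
          rw [integral_const_mul, integral_const_mul, ← mul_sub, abs_mul,
            abs_of_pos (inv_pos.2 hM), ← ENNReal.ofReal_mul hM.le, mul_inv_cancel_left₀ hM.ne']
      _ ≤ _ := by gcongr

/-- `κ` is geometrically ergodic with constants `C`, `ρ`, and its iterates integrate `V ≥ 1`. -/
structure GeometricallyErgodic (V : X → ℝ) (κ : Kernel X X) (C ρ : ℝ) : Prop where
  measurable : Measurable V
  one_le : ∀ y, 1 ≤ V y
  integrable_pow : ∀ n x, Integrable V ((κ ^ n) x)
  isErgodicityConst : IsErgodicityConst V κ C ρ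

/-- The distance `vDist` tests only functions integrable for both measures, so the ergodicity bound
reaches all `|f| ≤ M V` only once `V` is integrable. The drift inequality propagates this along the
iterates. -/
lemma integrable_pow_of_drift [IsMarkovKernel κ] (hVm : Measurable V) (hV : ∀ y, 1 ≤ V y)
    {lam b : ℝ}
    (hd : ∀ x, ∫⁻ y, ENNReal.ofReal (V y) ∂(κ x) ≤ ENNReal.ofReal (lam * V x + b)) (n : ℕ) (x : X) :
    Integrable V ((κ ^ n) x) := by
  refine ⟨hVm.aestronglyMeasurable, ?_⟩
  rw [hasFiniteIntegral_iff_ofReal (Eventually.of_forall fun y => by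
    simp only [Pi.zero_apply]; linarith [hV y])]
  induction n with
  | zero =>
    rw [pow_zero]
    change ∫⁻ y, ENNReal.ofReal (V y) ∂(Kernel.id x) < ∞
    rw [Kernel.id_apply, lintegral_dirac' _ hVm.ennreal_ofReal]
    exact ENNReal.ofReal_lt_top
  | succ n ih =>
    rw [pow_succ']
    change ∫⁻ y, ENNReal.ofReal (V y) ∂((κ ∘ₖ (κ ^ n)) x) < ∞
    rw [Kernel.lintegral_comp _ _ _ hVm.ennreal_ofReal]
    calc ∫⁻ y, ∫⁻ z, ENNReal.ofReal (V z) ∂(κ y) ∂((κ ^ n) x)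
        ≤ ∫⁻ y, ENNReal.ofReal ((|lam| + |b|) * V y) ∂((κ ^ n) x) := by
          refine lintegral_mono fun y => (hd y).trans (ENNReal.ofReal_le_ofReal ?_)
          have := hV y
          nlinarith [le_abs_self lam, le_abs_self b, abs_nonneg lam, abs_nonneg b]
      _ = ENNReal.ofReal (|lam| + |b|) * ∫⁻ y, ENNReal.ofReal (V y) ∂((κ ^ n) x) := by
          rw [← lintegral_const_mul _ hVm.ennreal_ofReal]
          simp_rw [ENNReal.ofReal_mul (add_nonneg (abs_nonneg lam) (abs_nonneg b))]
      _ < ∞ := ENNReal.mul_lt_top ENNReal.ofReal_lt_top ih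

instance isMarkovKernel_pow [IsMarkovKernel κ] (n : ℕ) : IsMarkovKernel (κ ^ n) := by
  induction n with
  | zero => rw [pow_zero]; exact inferInstanceAs (IsMarkovKernel Kernel.id)
  | succ n ih => rw [pow_succ']; exact inferInstanceAs (IsMarkovKernel (κ ∘ₖ (κ ^ n)))

lemma integral_pow_zero {f : X → ℝ} (hf : Measurable f) (x : X) :
    ∫ y, f y ∂((κ ^ 0) x) = f x := by
  rw [pow_zero]
  change ∫ y, f y ∂(Kernel.id x) = f x
  rw [Kernel.id_apply, integral_dirac' _ _ hf.stronglyMeasurable]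

lemma measurable_integral_kernel [IsMarkovKernel κ] {f : X → ℝ} (hf : Measurable f) :
    Measurable fun x => ∫ y, f y ∂(κ x) :=
  (hf.stronglyMeasurable.comp_measurable measurable_snd).integral_kernel_prod_right'
    (κ := κ) |>.measurable

namespace GeometricallyErgodic

variable [IsMarkovKernel κ]

lemma integrable_kernel (h : GeometricallyErgodic V κ C ρ) (x : X) : Integrable V (κ x) := by
  simpa using h.integrable_pow 1 x

lemma V_pos (h : GeometricallyErgodic V κ C ρ)
    (x : X) : 0 < V x := lt_of_lt_of_le one_pos (h.one_le x)

lemma C_nonneg (h : GeometricallyErgodic V κ C ρ) : 0 ≤ C := h.isErgodicityConst.1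

lemma rho_pos (h : GeometricallyErgodic V κ C ρ) : 0 < ρ := h.isErgodicityConst.2.1.1

lemma rho_lt_one (h : GeometricallyErgodic V κ C ρ) : ρ < 1 := h.isErgodicityConst.2.1.2

/-- This excludes the default value `0` of `invariantProb`: testing the ergodicity bound with the
constant `1` would give `1 ≤ C ρ^n V x` for every `n`. -/
lemma exists_invariant (h : GeometricallyErgodic V κ C ρ) [Nonempty X] :
    ∃ μ : Measure X, IsProbabilityMeasure μ ∧ Kernel.Invariant κ μ := by
  by_contra hne
  obtain ⟨x⟩ := ‹Nonempty X›
  have h0 : invariantProb κ = 0 := by rw [invariantProb, dif_neg hne]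
  have hle (n : ℕ) : 1 ≤ C * ρ ^ n * V x := by
    have h1 := ofReal_abs_integral_sub_le (μ₁ := (κ ^ n) x) (μ₂ := invariantProb κ)
      (f := fun _ => 1) h.one_le zero_le_one measurable_const (fun y => by simpa using h.one_le y)
      (integrable_const _) (by rw [h0]; exact integrable_zero_measure)
    have h2 := h1.trans (mul_le_mul_right (h.isErgodicityConst.2.2 n x) _)
    rw [h0] at h2
    simp only [integral_const, probReal_univ, smul_eq_mul, mul_one,
      ENNReal.ofReal_one, one_mul] at h2
    simpa using h2
  have ht : Tendsto (fun n => C * ρ ^ n * V x) atTop (𝓝 (C * 0 * V x)) :=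
    ((tendsto_pow_atTop_nhds_zero_of_lt_one h.rho_pos.le h.rho_lt_one).const_mul C).mul_const _
  have := ge_of_tendsto' ht hle
  norm_num at this

lemma isProbabilityMeasure (h : GeometricallyErgodic V κ C ρ)
    [Nonempty X] : IsProbabilityMeasure (invariantProb κ) := by
  rw [invariantProb, dif_pos h.exists_invariant]
  exact h.exists_invariant.choose_spec.1

lemma invariant (h : GeometricallyErgodic V κ C ρ)
    [Nonempty X] : Kernel.Invariant κ (invariantProb κ) := by
  rw [invariantProb, dif_pos h.exists_invariant]
  exact h.exists_invariant.choose_spec.2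

/-- `V` itself is not yet an admissible test function, but `min V M` is bounded. The ergodicity
bound at `n = 0` controls its integral by `(1 + C) V x` uniformly in `M`, and monotone convergence
applies. -/
lemma integrable_invariantProb (h : GeometricallyErgodic V κ C ρ)
    [Nonempty X] : Integrable V (invariantProb κ) := by
  have := h.isProbabilityMeasure
  obtain ⟨x⟩ := ‹Nonempty X›
  have hb (M : ℕ) : ∫⁻ y, ENNReal.ofReal (min (V y) M) ∂(invariantProb κ)
      ≤ ENNReal.ofReal ((1 + C) * V x) := by
    have hm : Measurable fun y => min (V y) (M : ℝ) := h.measurable.min measurable_const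
    have habs (y : X) : |min (V y) (M : ℝ)| = min (V y) M :=
      abs_of_nonneg (le_min (h.V_pos y).le (Nat.cast_nonneg M))
    have hi (ν : Measure X) [IsFiniteMeasure ν] : Integrable (fun y => min (V y) (M : ℝ)) ν :=
      (integrable_const (M : ℝ)).mono' hm.aestronglyMeasurable (Eventually.of_forall fun y => by
        rw [Real.norm_eq_abs, habs]; exact min_le_right _ _)
    have h1 := ofReal_abs_integral_sub_le (μ₁ := (κ ^ 0) x) (μ₂ := invariantProb κ) h.one_le
      zero_le_one hm (fun y => by rw [habs, one_mul]; exact min_le_left _ _) (hi _) (hi _)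
    have h2 := h1.trans (mul_le_mul_right (h.isErgodicityConst.2.2 0 x) _)
    rw [integral_pow_zero hm, ENNReal.ofReal_one, one_mul, ENNReal.ofReal_le_ofReal_iff (by
      have := h.C_nonneg; have := h.V_pos x; positivity)] at h2
    rw [← ofReal_integral_eq_lintegral_ofReal (hi _) (Eventually.of_forall fun y =>
      le_min (h.V_pos y).le (Nat.cast_nonneg M))]
    refine ENNReal.ofReal_le_ofReal ?_
    have := (abs_le.1 h2).1
    have := min_le_left (V x) (M : ℝ)
    simp only [pow_zero, mul_one] at *
    linarith
  refine ⟨h.measurable.aestronglyMeasurable, ?_⟩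
  rw [hasFiniteIntegral_iff_ofReal (Eventually.of_forall fun y => (h.V_pos y).le)]
  have hsup : (fun y => ENNReal.ofReal (V y)) =
      fun y => ⨆ M : ℕ, ENNReal.ofReal (min (V y) M) := by
    funext y
    refine le_antisymm ?_ (iSup_le fun M => ENNReal.ofReal_le_ofReal (min_le_left _ _))
    obtain ⟨M, hM⟩ := exists_nat_ge (V y)
    exact le_iSup_of_le M (by rw [min_eq_left hM])
  rw [hsup, lintegral_iSup (fun M => (h.measurable.min measurable_const).ennreal_ofReal)]
  · exact (iSup_le hb).trans_lt ENNReal.ofReal_lt_top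
  · intro M N hMN y
    exact ENNReal.ofReal_le_ofReal (min_le_min le_rfl (Nat.cast_le.2 hMN))

lemma integral_invariant (h : GeometricallyErgodic V κ C ρ)
    [Nonempty X] {f : X → ℝ} (hf : Integrable f (invariantProb κ)) :
    ∫ x, ∫ y, f y ∂(κ x) ∂(invariantProb κ) = ∫ y, f y ∂(invariantProb κ) := by
  have := h.isProbabilityMeasure
  obtain ⟨x⟩ := ‹Nonempty X›
  have h1 : (κ ∘ₖ Kernel.const X (invariantProb κ)) x = invariantProb κ := by
    rw [h.invariant.comp_const, Kernel.const_apply]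
  have h2 := Kernel.integral_comp (η := κ) (κ := Kernel.const X (invariantProb κ)) (a := x)
    (f := f) (by rw [h1]; exact hf)
  rw [h1] at h2
  simpa using h2.symm

lemma integral_pow_succ (h : GeometricallyErgodic V κ C ρ)
    {f : X → ℝ} {M : ℝ} (hf : Measurable f) (hfV : ∀ y, |f y| ≤ M * V y)
    (n : ℕ) (x : X) :
    ∫ y, f y ∂((κ ^ (n + 1)) x) = ∫ z, ∫ y, f y ∂((κ ^ n) z) ∂(κ x) := by
  have h1 := integrable_of_abs_le_mul (h.integrable_pow (n + 1) x) hf hfV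
  rw [pow_succ] at h1 ⊢
  exact Kernel.integral_comp (η := κ ^ n) (κ := κ) (a := x) h1

lemma integral_pow_succ' (h : GeometricallyErgodic V κ C ρ)
    {f : X → ℝ} {M : ℝ} (hf : Measurable f) (hfV : ∀ y, |f y| ≤ M * V y)
    (n : ℕ) (x : X) :
    ∫ y, f y ∂((κ ^ (n + 1)) x) = ∫ z, ∫ y, f y ∂(κ z) ∂((κ ^ n) x) := by
  have h1 := integrable_of_abs_le_mul (h.integrable_pow (n + 1) x) hf hfV
  rw [pow_succ'] at h1 ⊢
  exact Kernel.integral_comp (η := κ) (κ := κ ^ n) (a := x) h1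

lemma abs_integral_pow_sub_le (h : GeometricallyErgodic V κ C ρ)
    [Nonempty X] {f : X → ℝ} {M : ℝ} (hM : 0 ≤ M) (hf : Measurable f)
    (hfV : ∀ y, |f y| ≤ M * V y) (n : ℕ) (x : X) :
    |∫ y, f y ∂((κ ^ n) x) - ∫ y, f y ∂(invariantProb κ)| ≤ M * (C * ρ ^ n * V x) := by
  have h1 := ofReal_abs_integral_sub_le h.one_le hM hf hfV
    (integrable_of_abs_le_mul (h.integrable_pow n x) hf hfV)
    (integrable_of_abs_le_mul h.integrable_invariantProb hf hfV)
  have h2 := h1.trans (mul_le_mul_right (h.isErgodicityConst.2.2 n x) _)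
  have := h.C_nonneg; have := h.V_pos x; have := h.rho_pos
  rwa [← ENNReal.ofReal_mul hM, ENNReal.ofReal_le_ofReal_iff (by positivity)] at h2

end GeometricallyErgodic

end Poisson

/-! ### The Poisson equation and its dependence on the kernel. -/

section PoissonSolution

variable {X : Type*} [MeasurableSpace X] {V : X → ℝ} {κ η : Kernel X X} {C ρ C' ρ' : ℝ}

/-- The solution `∑ₙ (κⁿ f - π f)` of the Poisson equation `H - κ H = f - π f`. -/
noncomputable def poisson (κ : Kernel X X) (f : X → ℝ) (x : X) : ℝ :=
  ∑' n : ℕ, (∫ y, f y ∂((κ ^ n) x) - ∫ y, f y ∂(invariantProb κ))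

lemma abs_integral_kernel_sub_le {φ : X → ℝ} {M D : ℝ} (hV : ∀ y, 1 ≤ V y) (hM : 0 ≤ M)
    (hD : 0 ≤ D) (hκη : kernelVariation V κ η ≤ ENNReal.ofReal D) (hφ : Measurable φ)
    (hφV : ∀ y, |φ y| ≤ M * V y) (x : X) (hκ : Integrable V (κ x)) (hη : Integrable V (η x)) :
    |∫ y, φ y ∂(κ x) - ∫ y, φ y ∂(η x)| ≤ M * D * V x := by
  have hVx : 0 < V x := lt_of_lt_of_le one_pos (hV x)
  have h1 := ofReal_abs_integral_sub_le hV hM hφ hφV (integrable_of_abs_le_mul hκ hφ hφV)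
    (integrable_of_abs_le_mul hη hφ hφV)
  have h2 : vDist V (κ x) (η x) ≤ ENNReal.ofReal (D * V x) := by
    have := (le_iSup (fun x => vDist V (κ x) (η x) / ENNReal.ofReal (V x)) x).trans hκη
    rw [ENNReal.div_le_iff (by simpa using hVx) ENNReal.ofReal_ne_top] at this
    rwa [ENNReal.ofReal_mul hD]
  have h3 := h1.trans (mul_le_mul_right h2 _)
  rw [← ENNReal.ofReal_mul hM, ENNReal.ofReal_le_ofReal_iff (by positivity)] at h3
  linarith

namespace GeometricallyErgodic

variable [IsMarkovKernel κ] [Nonempty X]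

lemma const_nonneg (h : GeometricallyErgodic V κ C ρ) : 0 ≤ C / (1 - ρ) :=
  div_nonneg h.C_nonneg (by linarith [h.rho_lt_one])

lemma hasSum_bound (h : GeometricallyErgodic V κ C ρ) (M : ℝ) (x : X) :
    HasSum (fun n => M * (C * ρ ^ n * V x)) (M * (C / (1 - ρ)) * V x) := by
  have := ((hasSum_geometric_of_lt_one h.rho_pos.le h.rho_lt_one).mul_left (M * C)).mul_right (V x)
  convert! this using 1
  · funext n; ring
  · ring

lemma hasSum_poisson (h : GeometricallyErgodic V κ C ρ)
    {f : X → ℝ} {M : ℝ} (hM : 0 ≤ M) (hf : Measurable f)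
    (hfV : ∀ y, |f y| ≤ M * V y) (x : X) :
    HasSum (fun n : ℕ => ∫ y, f y ∂((κ ^ n) x) - ∫ y, f y ∂(invariantProb κ)) (poisson κ f x) :=
  (Summable.of_norm_bounded (h.hasSum_bound M x).summable fun n => by
    simpa using h.abs_integral_pow_sub_le hM hf hfV n x).hasSum

lemma abs_poisson_le (h : GeometricallyErgodic V κ C ρ)
    {f : X → ℝ} {M : ℝ} (hM : 0 ≤ M) (hf : Measurable f)
    (hfV : ∀ y, |f y| ≤ M * V y) (x : X) : |poisson κ f x| ≤ M * (C / (1 - ρ)) * V x := by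
  rw [poisson, ← Real.norm_eq_abs]
  exact tsum_of_norm_bounded (h.hasSum_bound M x) (h.abs_integral_pow_sub_le hM hf hfV · x)

lemma measurable_poisson (h : GeometricallyErgodic V κ C ρ)
    {f : X → ℝ} {M : ℝ} (hM : 0 ≤ M) (hf : Measurable f)
    (hfV : ∀ y, |f y| ≤ M * V y) : Measurable (poisson κ f) := by
  refine measurable_of_tendsto_metrizable
    (f := fun N x => ∑ n ∈ Finset.range N,
      (∫ y, f y ∂((κ ^ n) x) - ∫ y, f y ∂(invariantProb κ))) (fun N => ?_)
    (tendsto_pi_nhds.2 fun x => (h.hasSum_poisson hM hf hfV x).tendsto_sum_nat)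
  exact Finset.measurable_fun_sum _ fun n _ => (measurable_integral_kernel hf).sub_const _

/-- The geometric bound dominates the series, so sum and integral may be exchanged. With `ν = κ x`
the series is shifted by one index, which is the Poisson equation; with `ν` invariant every term
vanishes, so the solution is centred. -/
lemma integral_poisson_eq_tsum (h : GeometricallyErgodic V κ C ρ)
    {f : X → ℝ} {M : ℝ} (hM : 0 ≤ M) (hf : Measurable f)
    (hfV : ∀ y, |f y| ≤ M * V y) {ν : Measure X} (hν : Integrable V ν) [IsProbabilityMeasure ν] :
    HasSum (fun n : ℕ => ∫ x, ∫ y, f y ∂((κ ^ n) x) ∂ν - ∫ y, f y ∂(invariantProb κ))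
      (∫ x, poisson κ f x ∂ν) := by
  have hm (n : ℕ) : Measurable fun x => ∫ y, f y ∂((κ ^ n) x) - ∫ y, f y ∂(invariantProb κ) :=
    (measurable_integral_kernel hf).sub_const _
  have hb (n : ℕ) (x : X) : |∫ y, f y ∂((κ ^ n) x) - ∫ y, f y ∂(invariantProb κ)| ≤
      M * (C * ρ ^ n) * V x := by
    rw [mul_assoc]; exact h.abs_integral_pow_sub_le hM hf hfV n x
  have hi (n : ℕ) := integrable_of_abs_le_mul hν (hm n) (hb n)
  have key := hasSum_integral_of_summable_integral_norm hi (by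
    refine Summable.of_nonneg_of_le (fun n => integral_nonneg fun x => norm_nonneg _)
      (fun n => integral_mono (hi n).norm (hν.const_mul _) (hb n)) ?_
    simp_rw [integral_const_mul]
    exact ((((hasSum_geometric_of_lt_one h.rho_pos.le h.rho_lt_one).summable.mul_left
      C).mul_left M).mul_right _))
  convert! key using 1
  funext n
  have hi' : Integrable (fun x => ∫ y, f y ∂((κ ^ n) x)) ν := by
    refine ((hi n).add (integrable_const (∫ y, f y ∂(invariantProb κ)))).congr
      (Eventually.of_forall fun x => ?_)
    simp only [Pi.add_apply, sub_add_cancel]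
  rw [integral_sub hi' (integrable_const _)]
  simp

lemma poisson_sub_integral (h : GeometricallyErgodic V κ C ρ)
    {f : X → ℝ} {M : ℝ} (hM : 0 ≤ M) (hf : Measurable f)
    (hfV : ∀ y, |f y| ≤ M * V y) (x : X) :
    poisson κ f x - ∫ y, poisson κ f y ∂(κ x) = f x - ∫ y, f y ∂(invariantProb κ) := by
  have h1 := h.integral_poisson_eq_tsum hM hf hfV (h.integrable_kernel x)
  simp_rw [← h.integral_pow_succ hf hfV] at h1
  have h2 := (hasSum_nat_add_iff' 1).2 (h.hasSum_poisson hM hf hfV x)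
  have h3 := h1.unique h2
  rw [Finset.sum_range_one, integral_pow_zero hf] at h3
  linarith

lemma integral_pow_invariant (h : GeometricallyErgodic V κ C ρ)
    {f : X → ℝ} {M : ℝ} (hM : 0 ≤ M) (hf : Measurable f)
    (hfV : ∀ y, |f y| ≤ M * V y) (n : ℕ) :
    ∫ x, ∫ y, f y ∂((κ ^ n) x) ∂(invariantProb κ) = ∫ y, f y ∂(invariantProb κ) := by
  have := h.isProbabilityMeasure
  induction n with
  | zero => simp_rw [integral_pow_zero hf]
  | succ n ih =>
    simp_rw [h.integral_pow_succ hf hfV]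
    rw [h.integral_invariant, ih]
    have hm : Measurable fun x => ∫ y, f y ∂((κ ^ n) x) - ∫ y, f y ∂(invariantProb κ) :=
      (measurable_integral_kernel hf).sub_const _
    have hi := integrable_of_abs_le_mul (M := M * (C * ρ ^ n)) h.integrable_invariantProb hm
      fun x => by rw [mul_assoc]; exact h.abs_integral_pow_sub_le hM hf hfV n x
    refine (hi.add (integrable_const (∫ y, f y ∂(invariantProb κ)))).congr
      (Eventually.of_forall fun x => ?_)
    simp only [Pi.add_apply, sub_add_cancel]

lemma integral_poisson_invariantProb (h : GeometricallyErgodic V κ C ρ)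
    {f : X → ℝ} {M : ℝ} (hM : 0 ≤ M) (hf : Measurable f)
    (hfV : ∀ y, |f y| ≤ M * V y) : ∫ x, poisson κ f x ∂(invariantProb κ) = 0 := by
  have := h.isProbabilityMeasure
  have h1 := h.integral_poisson_eq_tsum hM hf hfV h.integrable_invariantProb
  simp_rw [h.integral_pow_invariant hM hf hfV, sub_self] at h1
  exact h1.unique hasSum_zero

lemma poisson_sub (h : GeometricallyErgodic V κ C ρ)
    {f g : X → ℝ} {M : ℝ} (hM : 0 ≤ M) (hf : Measurable f)
    (hfV : ∀ y, |f y| ≤ M * V y) (hg : Measurable g) (hgV : ∀ y, |g y| ≤ M * V y) (x : X) :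
    poisson κ (fun y => f y - g y) x = poisson κ f x - poisson κ g x := by
  have h1 := (h.hasSum_poisson hM hf hfV x).sub (h.hasSum_poisson hM hg hgV x)
  rw [← h1.tsum_eq, poisson]
  congr 1
  funext n
  rw [integral_sub, integral_sub]
  · ring
  · exact integrable_of_abs_le_mul h.integrable_invariantProb hf hfV
  · exact integrable_of_abs_le_mul h.integrable_invariantProb hg hgV
  · exact integrable_of_abs_le_mul (h.integrable_pow n x) hf hfV
  · exact integrable_of_abs_le_mul (h.integrable_pow n x) hg hgV

/-- A function `g` with `g - κ g = q + const` is `π g` plus the Poisson solution for `q`. -/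
lemma sub_integral_eq_poisson (h : GeometricallyErgodic V κ C ρ)
    {g q : X → ℝ} {M M' c : ℝ} (hM : 0 ≤ M) (hg : Measurable g)
    (hgV : ∀ y, |g y| ≤ M * V y) (hq : Measurable q) (hqV : ∀ y, |q y| ≤ M' * V y)
    (hgq : ∀ y, g y - ∫ z, g z ∂(κ y) = q y + c) (x : X) :
    g x - ∫ y, g y ∂(invariantProb κ) = poisson κ q x := by
  have := h.isProbabilityMeasure
  have hκ (ν : Measure X) [IsProbabilityMeasure ν] (hν : Integrable V ν) :
      ∫ y, q y ∂ν + c = ∫ y, g y ∂ν - ∫ y, ∫ z, g z ∂(κ y) ∂ν := by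
    have hgi := integrable_of_abs_le_mul hν hg hgV
    have hqi := integrable_of_abs_le_mul hν hq hqV
    have hκi : Integrable (fun y => ∫ z, g z ∂(κ y)) ν := by
      refine (hgi.sub (hqi.add (integrable_const c))).congr (Eventually.of_forall fun y => ?_)
      have := hgq y
      simp only [Pi.sub_apply, Pi.add_apply]
      linarith
    rw [← integral_sub hgi hκi]
    simp_rw [hgq]
    rw [integral_add hqi (integrable_const c)]
    simp
  -- Integrating the equation against the invariant measure determines the constant; the centred
  -- iterates of `q` are then increments of the iterates of `g`, and the Poisson series telescopes.
  have hπ : ∫ y, q y ∂(invariantProb κ) = -c := by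
    have := hκ _ h.integrable_invariantProb
    rw [h.integral_invariant (integrable_of_abs_le_mul h.integrable_invariantProb hg hgV)] at this
    linarith
  have hn (n : ℕ) : ∫ y, q y ∂((κ ^ n) x) - ∫ y, q y ∂(invariantProb κ) =
      ∫ y, g y ∂((κ ^ n) x) - ∫ y, g y ∂((κ ^ (n + 1)) x) := by
    rw [h.integral_pow_succ' hg hgV, ← hκ _ (h.integrable_pow n x), hπ]
    ring
  have hM' : 0 ≤ M' := by
    obtain ⟨y⟩ := ‹Nonempty X›
    by_contra hneg
    have := (abs_nonneg _).trans (hqV y)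
    nlinarith [h.V_pos y]
  have h1 := (h.hasSum_poisson hM' hq hqV x).tendsto_sum_nat
  simp_rw [hn, Finset.sum_range_sub', integral_pow_zero hg] at h1
  have h2 := (h.hasSum_poisson hM hg hgV x).summable.tendsto_atTop_zero
  have h3 : Tendsto (fun n => g x - ∫ y, g y ∂((κ ^ n) x)) atTop
      (𝓝 (g x - ∫ y, g y ∂(invariantProb κ))) := by
    have := (h2.const_sub (g x)).sub_const (∫ y, g y ∂(invariantProb κ))
    rw [sub_zero] at this
    exact this.congr fun n => by ring
  exact tendsto_nhds_unique h3 h1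

variable [IsMarkovKernel η]

/-- With `H` the Poisson solution for `η` and `φ`, invariance of `π_κ` turns `π_κ φ - π_η φ = π_κ (H
- η H)` into `π_κ (κ H - η H)`, whose integrand is small when the kernels are close. -/
lemma abs_integral_invariantProb_sub_le (h : GeometricallyErgodic V κ C ρ)
    (h' : GeometricallyErgodic V η C' ρ') {φ : X → ℝ} {M D : ℝ} (hM : 0 ≤ M) (hD : 0 ≤ D)
    (hκη : kernelVariation V κ η ≤ ENNReal.ofReal D) (hφ : Measurable φ)
    (hφV : ∀ y, |φ y| ≤ M * V y) :
    |∫ y, φ y ∂(invariantProb κ) - ∫ y, φ y ∂(invariantProb η)| ≤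
      M * (C' / (1 - ρ')) * D * ∫ y, V y ∂(invariantProb κ) := by
  have := h.isProbabilityMeasure
  set H := poisson η φ
  have hHm : Measurable H := h'.measurable_poisson hM hφ hφV
  have hHV : ∀ y, |H y| ≤ M * (C' / (1 - ρ')) * V y := h'.abs_poisson_le hM hφ hφV
  have hV := h.integrable_invariantProb
  have hφi := integrable_of_abs_le_mul hV hφ hφV
  have hHi := integrable_of_abs_le_mul hV hHm hHV
  have hb (y : X) := abs_integral_kernel_sub_le h.one_le (mul_nonneg hM h'.const_nonneg) hD hκη
    hHm hHV y (h.integrable_kernel y) (h'.integrable_kernel y)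
  have hqi := integrable_of_abs_le_mul hV
    ((measurable_integral_kernel (κ := κ) hHm).sub (measurable_integral_kernel (κ := η) hHm)) hb
  have hηi : Integrable (fun y => ∫ z, H z ∂(η y)) (invariantProb κ) := by
    refine ((hHi.sub hφi).add (integrable_const (∫ y, φ y ∂(invariantProb η)))).congr
      (Eventually.of_forall fun y => ?_)
    have := h'.poisson_sub_integral hM hφ hφV y
    simp only [Pi.sub_apply, Pi.add_apply]
    linarith
  have hκi : Integrable (fun y => ∫ z, H z ∂(κ y)) (invariantProb κ) := by
    refine (hqi.add hηi).congr (Eventually.of_forall fun y => ?_)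
    simp
  have hs : ∫ y, (H y - ∫ z, H z ∂(η y)) ∂(invariantProb κ) =
      ∫ y, φ y ∂(invariantProb κ) - ∫ y, φ y ∂(invariantProb η) := by
    simp_rw [H, h'.poisson_sub_integral hM hφ hφV]
    rw [integral_sub hφi (integrable_const _)]
    simp
  rw [← hs, integral_sub hHi hηi, ← h.integral_invariant hHi, ← integral_sub hκi hηi,
    ← integral_const_mul]
  exact (norm_integral_le_integral_norm _).trans (integral_mono hqi.norm (hV.const_mul _) hb)

/-- Lipschitz dependence of the Poisson solution on the kernel. -/
lemma abs_poisson_sub_poisson_le (h : GeometricallyErgodic V κ C ρ)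
    (h' : GeometricallyErgodic V η C' ρ') {f : X → ℝ} {M D : ℝ} (hM : 0 ≤ M) (hD : 0 ≤ D)
    (hκη : kernelVariation V κ η ≤ ENNReal.ofReal D) (hf : Measurable f)
    (hfV : ∀ y, |f y| ≤ M * V y) (x : X) :
    |poisson κ f x - poisson η f x| ≤ M * D * (C' / (1 - ρ')) *
      (C / (1 - ρ) * V x + C' / (1 - ρ') * ∫ y, V y ∂(invariantProb κ)) := by
  set H := poisson κ f
  set H' := poisson η f
  have hc := h.const_nonneg
  have hc' := h'.const_nonneg
  have hHm : Measurable H := h.measurable_poisson hM hf hfV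
  have hHV : ∀ y, |H y| ≤ M * (C / (1 - ρ)) * V y := h.abs_poisson_le hM hf hfV
  have hHm' : Measurable H' := h'.measurable_poisson hM hf hfV
  have hHV' : ∀ y, |H' y| ≤ M * (C' / (1 - ρ')) * V y := h'.abs_poisson_le hM hf hfV
  have hgV (y : X) : |H y - H' y| ≤ (M * (C / (1 - ρ)) + M * (C' / (1 - ρ'))) * V y := by
    rw [add_mul]
    exact (abs_sub _ _).trans (add_le_add (hHV y) (hHV' y))
  have hq (y : X) := abs_integral_kernel_sub_le h.one_le (mul_nonneg hM h'.const_nonneg) hD hκη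
    hHm' hHV' y (h.integrable_kernel y) (h'.integrable_kernel y)
  have hqm := (measurable_integral_kernel (κ := κ) hHm').sub
    (measurable_integral_kernel (κ := η) hHm')
  -- Subtracting the two Poisson equations, `H - H'` solves the equation for `κ` with right-hand
  -- side `κ H' - η H'` plus a constant. Only its mean `-π_κ H'` remains; as `π_η H' = 0`, the
  -- comparison of the invariant measures bounds it.
  have key := h.sub_integral_eq_poisson (c := ∫ y, f y ∂(invariantProb η) -
    ∫ y, f y ∂(invariantProb κ)) (by positivity) (hHm.sub hHm') hgV hqm hq (fun y => by
      have h1 := h.poisson_sub_integral hM hf hfV y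
      have h2 := h'.poisson_sub_integral hM hf hfV y
      simp only [Pi.sub_apply]
      rw [integral_sub (integrable_of_abs_le_mul (h.integrable_kernel y) hHm hHV)
        (integrable_of_abs_le_mul (h.integrable_kernel y) hHm' hHV')]
      simp only [H, H']
      linarith) x
  have hb := h.abs_poisson_le (by positivity) hqm hq x
  rw [← key] at hb
  have hV := h.integrable_invariantProb
  simp only [Pi.sub_apply] at hb
  rw [integral_sub (integrable_of_abs_le_mul hV hHm hHV)
    (integrable_of_abs_le_mul hV hHm' hHV'), h.integral_poisson_invariantProb hM hf hfV] at hb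
  have h4 := h.abs_integral_invariantProb_sub_le h' (by positivity) hD hκη hHm' hHV'
  rw [h'.integral_poisson_invariantProb hM hf hfV, sub_zero] at h4
  calc |H x - H' x| = |(H x - H' x - (0 - ∫ y, H' y ∂(invariantProb κ))) +
        -∫ y, H' y ∂(invariantProb κ)| := by
          ring_nf
    _ ≤ M * (C' / (1 - ρ')) * D * (C / (1 - ρ)) * V x +
        M * (C' / (1 - ρ')) * (C' / (1 - ρ')) * D * ∫ y, V y ∂(invariantProb κ) :=
      (abs_add_le _ _).trans (by rw [abs_neg]; exact add_le_add hb h4)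
    _ = _ := by ring

end GeometricallyErgodic

end PoissonSolution

/-! ### Measurability in the parameter. -/

section JointMeasurability

variable {X Θ : Type*} [MeasurableSpace X] [MeasurableSpace Θ]

lemma measurable_pow_apply {P : Θ → Kernel X X} [∀ t, IsMarkovKernel (P t)]
    (hP : Measurable fun p : Θ × X => P p.1 p.2) (n : ℕ) :
    Measurable fun p : Θ × X => (P p.1 ^ n) p.2 := by
  induction n with
  | zero =>
    have : (fun p : Θ × X => (P p.1 ^ 0) p.2) = fun p => Measure.dirac p.2 :=
      funext fun p => by rw [pow_zero]; exact Kernel.id_apply p.2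
    rw [this]
    exact Measure.measurable_dirac.comp measurable_snd
  | succ n ih =>
    let K : Kernel (Θ × X) X := ⟨_, ih⟩
    have : IsMarkovKernel K := ⟨fun p => inferInstanceAs (IsProbabilityMeasure ((P p.1 ^ n) p.2))⟩
    refine Measure.measurable_of_measurable_coe _ fun s hs => ?_
    simp_rw [Kernel.pow_succ_apply_eq_lintegral _ _ _ hs]
    exact Measurable.lintegral_kernel_prod_right' (κ := K)
      (f := fun q : (Θ × X) × X => P q.1.1 q.2 s)
      ((Measure.measurable_coe hs).comp (hP.comp (measurable_fst.fst.prodMk measurable_snd)))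

lemma measurable_integral_family {P : Θ → Kernel X X} [∀ t, IsMarkovKernel (P t)]
    (hP : Measurable fun p : Θ × X => P p.1 p.2) {G : Θ × X → ℝ} (hG : Measurable G) :
    Measurable fun p : Θ × X => ∫ y, G (p.1, y) ∂(P p.1 p.2) := by
  let K : Kernel (Θ × X) X := ⟨_, hP⟩
  have : IsMarkovKernel K := ⟨fun p => inferInstanceAs (IsProbabilityMeasure (P p.1 p.2))⟩
  exact (hG.comp (measurable_fst.fst.prodMk measurable_snd)).stronglyMeasurable
    |>.integral_kernel_prod_right' (κ := K) |>.measurable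

lemma measurable_lintegral_family {P : Θ → Kernel X X} [∀ t, IsMarkovKernel (P t)]
    (hP : Measurable fun p : Θ × X => P p.1 p.2) {G : Θ × X → ℝ≥0∞} (hG : Measurable G) :
    Measurable fun p : Θ × X => ∫⁻ y, G (p.1, y) ∂(P p.1 p.2) := by
  let K : Kernel (Θ × X) X := ⟨_, hP⟩
  have : IsMarkovKernel K := ⟨fun p => inferInstanceAs (IsProbabilityMeasure (P p.1 p.2))⟩
  exact (hG.comp (measurable_fst.fst.prodMk measurable_snd)).lintegral_kernel_prod_right' (κ := K)

/-- The upper limit in `EReal` is measurable whether or not the sequence converges, and agrees with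
the limit wherever a real one exists. -/
lemma exists_measurable_limit {α : Type*} [MeasurableSpace α] {u : ℕ → α → ℝ}
    (hu : ∀ n, Measurable (u n)) :
    ∃ g : α → ℝ, Measurable g ∧ ∀ a l, Tendsto (fun n => u n a) atTop (𝓝 l) → g a = l := by
  refine ⟨fun a => (limsup (fun n => (u n a : EReal)) atTop).toReal,
    (Measurable.limsup fun n => (hu n).coe_real_ereal).ereal_toReal, fun a l h => ?_⟩
  have h' : Tendsto (fun n => (u n a : EReal)) atTop (𝓝 (l : EReal)) :=
    (continuous_coe_real_ereal.tendsto l).comp h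
  simp only
  rw [h'.limsup_eq, EReal.toReal_coe]

/-- The Poisson solutions of a measurable family of kernels have a jointly measurable version. -/
lemma exists_measurable_poisson [Nonempty X] {P : Θ → Kernel X X} [∀ t, IsMarkovKernel (P t)]
    (hP : Measurable fun p : Θ × X => P p.1 p.2) {V : X → ℝ} {G : X → Θ → ℝ} {M : ℝ} (hM : 0 ≤ M)
    (hG : Measurable fun p : X × Θ => G p.1 p.2) (hGV : ∀ y t, |G y t| ≤ M * V y) :
    ∃ (H : Θ × X → ℝ) (m : Θ → ℝ), Measurable H ∧ Measurable m ∧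
      ∀ t C ρ, GeometricallyErgodic V (P t) C ρ →
        (∀ y, H (t, y) = poisson (P t) (fun y => G y t) y) ∧
        m t = ∫ y, G y t ∂(invariantProb (P t)) := by
  obtain ⟨x₀⟩ := id ‹Nonempty X›
  have hQ (n : ℕ) : Measurable fun p : Θ × X => ∫ y, G y p.1 ∂((P p.1 ^ n) p.2) :=
    measurable_integral_family (P := fun t => P t ^ n) (measurable_pow_apply hP n)
      (hG.comp measurable_swap)
  have hGt (t : Θ) : Measurable fun y => G y t := hG.comp measurable_prodMk_right
  -- The invariant measures are picked by choice, so measurability of their means in `t` is obtained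
  -- from the limit of the iterates at a fixed base point.
  obtain ⟨m, hm, hmlim⟩ := exists_measurable_limit
    (fun n => (hQ n).comp (measurable_prodMk_right (y := x₀)))
  obtain ⟨H, hH, hHlim⟩ := exists_measurable_limit (fun N => Finset.measurable_fun_sum
    (Finset.range N) fun n _ => (hQ n).sub (hm.comp measurable_fst))
  refine ⟨H, m, hH, hm, fun t C ρ h => ?_⟩
  have hmt : m t = ∫ y, G y t ∂(invariantProb (P t)) := by
    refine hmlim t _ ?_
    have := (h.hasSum_poisson hM (hGt t) (hGV · t) x₀).summable.tendsto_atTop_zero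
    simpa using this.add_const (∫ y, G y t ∂(invariantProb (P t)))
  refine ⟨fun y => hHlim (t, y) _ ?_, hmt⟩
  change Tendsto (fun N => ∑ n ∈ Finset.range N, (∫ z, G z t ∂((P t ^ n) y) - m t)) atTop _
  rw [hmt]
  exact (h.hasSum_poisson hM (hGt t) (hGV · t) y).tendsto_sum_nat

end JointMeasurability

/-! ### The Markov property with random parameters. -/

section Transition

variable {X Θ Ω : Type*} [MeasurableSpace X] [MeasurableSpace Θ] {m mΩ : MeasurableSpace Ω}
  {P : Θ → Kernel X X} [∀ t, IsMarkovKernel (P t)] {μ : Measure Ω} [IsProbabilityMeasure μ]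

/-- The family `P` as one kernel in the parameter and the state. -/
noncomputable def familyKernel (P : Θ → Kernel X X) (hP : Measurable fun p : Θ × X => P p.1 p.2) :
    Kernel (Θ × X) X := ⟨fun p => P p.1 p.2, hP⟩

instance (hP : Measurable fun p : Θ × X => P p.1 p.2) : IsMarkovKernel (familyKernel P hP) :=
  ⟨fun p => inferInstanceAs (IsProbabilityMeasure (P p.1 p.2))⟩

variable {x x' : Ω → X} {θ : Ω → Θ} {A : Set Ω}

/-- The joint law of parameter, state and next state on an event of the past. -/
lemma map_restrict_eq_compProd (hP : Measurable fun p : Θ × X => P p.1 p.2) (hm : m ≤ mΩ)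
    (hx : Measurable[m] x) (hθ : Measurable[m] θ) (hx' : Measurable x')
    (hMarkov : ∀ f : X → ℝ, Measurable f → (∃ M : ℝ, ∀ y, |f y| ≤ M) →
      μ[fun ω => f (x' ω) | m] =ᵐ[μ] fun ω => ∫ y, f y ∂(P (θ ω) (x ω)))
    (hA : MeasurableSet[m] A) :
    (μ.restrict A).map (fun ω => ((θ ω, x ω), x' ω)) =
      ((μ.restrict A).map fun ω => (θ ω, x ω)) ⊗ₘ familyKernel P hP := by
  set K := familyKernel P hP
  have hpm : Measurable[m] fun ω => (θ ω, x ω) := hθ.prodMk hx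
  have hp : Measurable fun ω => (θ ω, x ω) := hpm.mono hm le_rfl
  -- The hypothesis only concerns bounded functions of the next state. On a rectangle `s × t`, the
  -- set `s` is part of the past event and `t` enters through its indicator, so rectangles suffice.
  refine Measure.ext_prod fun {s} {t} hs ht => ?_
  rw [Measure.map_apply (hp.prodMk hx') (hs.prod ht), Measure.compProd_apply_prod hs ht,
    setLIntegral_map hs (K.measurable_coe ht) hp]
  have hsm : MeasurableSet[m] ((fun ω => (θ ω, x ω)) ⁻¹' s ∩ A) := (hpm hs).inter hA
  rw [Measure.restrict_restrict (hp hs)]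
  have h1 := hMarkov (t.indicator fun _ => 1) (measurable_const.indicator ht)
    ⟨1, fun y => by by_cases hy : y ∈ t <;> simp [hy]⟩
  have hint : Integrable (fun ω => t.indicator (fun _ => (1 : ℝ)) (x' ω)) μ :=
    (integrable_const (1 : ℝ)).mono'
      ((measurable_const.indicator ht).comp hx').aestronglyMeasurable
      (Eventually.of_forall fun ω => by by_cases hy : x' ω ∈ t <;> simp [hy])
  have h2 := setIntegral_condExp hm hint hsm
  rw [setIntegral_congr_ae (hm _ hsm) (h1.mono fun ω h _ => h)] at h2
  have h3 : ∀ ω, ∫ y, t.indicator (fun _ => (1 : ℝ)) y ∂(P (θ ω) (x ω)) =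
      (K (θ ω, x ω) t).toReal := fun ω => integral_indicator_one ht
  have h4 : ∫ ω in (fun ω => (θ ω, x ω)) ⁻¹' s ∩ A, t.indicator (fun _ => (1 : ℝ)) (x' ω) ∂μ =
      (μ (x' ⁻¹' t ∩ ((fun ω => (θ ω, x ω)) ⁻¹' s ∩ A))).toReal := by
    have := integral_indicator_one (μ := μ.restrict ((fun ω => (θ ω, x ω)) ⁻¹' s ∩ A)) (hx' ht)
    rw [Measure.real, Measure.restrict_apply (hx' ht)] at this
    exact this
  simp_rw [h3] at h2
  rw [h4, integral_toReal (f := fun ω => K (θ ω, x ω) t)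
    ((K.measurable_coe ht).comp hp).aemeasurable
    (Eventually.of_forall fun ω => measure_lt_top _ _)] at h2
  have hfin : ∫⁻ ω in (fun ω => (θ ω, x ω)) ⁻¹' s ∩ A, K (θ ω, x ω) t ∂μ ≠ ∞ := by
    refine ne_of_lt (lt_of_le_of_lt (lintegral_mono fun ω => prob_le_one) ?_)
    simp
  rw [ENNReal.toReal_eq_toReal_iff' hfin (measure_ne_top _ _)] at h2
  rw [h2, Measure.restrict_apply ((hp.prodMk hx') (hs.prod ht))]
  congr 1
  ext ω
  simp only [Set.mem_inter_iff, Set.mem_preimage, Set.mem_prod]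
  tauto

/-- The Markov property, integrated against functions of the current parameter and next state. -/
lemma setLIntegral_transition (hP : Measurable fun p : Θ × X => P p.1 p.2) (hm : m ≤ mΩ)
    (hx : Measurable[m] x) (hθ : Measurable[m] θ) (hx' : Measurable x')
    (hMarkov : ∀ f : X → ℝ, Measurable f → (∃ M : ℝ, ∀ y, |f y| ≤ M) →
      μ[fun ω => f (x' ω) | m] =ᵐ[μ] fun ω => ∫ y, f y ∂(P (θ ω) (x ω)))
    (hA : MeasurableSet[m] A) {f : Θ × X → ℝ≥0∞} (hf : Measurable f) :
    ∫⁻ ω in A, f (θ ω, x' ω) ∂μ = ∫⁻ ω in A, ∫⁻ y, f (θ ω, y) ∂(P (θ ω) (x ω)) ∂μ := by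
  have hp : Measurable fun ω => (θ ω, x ω) := (hθ.prodMk hx).mono hm le_rfl
  have hfm : Measurable fun q : (Θ × X) × X => f (q.1.1, q.2) :=
    hf.comp (measurable_fst.fst.prodMk measurable_snd)
  calc ∫⁻ ω in A, f (θ ω, x' ω) ∂μ
      = ∫⁻ q, f (q.1.1, q.2) ∂((μ.restrict A).map (fun ω => ((θ ω, x ω), x' ω))) :=
        (lintegral_map hfm (hp.prodMk hx')).symm
    _ = _ := by
        rw [map_restrict_eq_compProd hP hm hx hθ hx' hMarkov hA, Measure.lintegral_compProd hfm,
          lintegral_map hfm.lintegral_kernel_prod_right' hp]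
        rfl

lemma setIntegral_transition (hP : Measurable fun p : Θ × X => P p.1 p.2) (hm : m ≤ mΩ)
    (hx : Measurable[m] x) (hθ : Measurable[m] θ) (hx' : Measurable x')
    (hMarkov : ∀ f : X → ℝ, Measurable f → (∃ M : ℝ, ∀ y, |f y| ≤ M) →
      μ[fun ω => f (x' ω) | m] =ᵐ[μ] fun ω => ∫ y, f y ∂(P (θ ω) (x ω)))
    (hA : MeasurableSet[m] A) {f : Θ × X → ℝ} (hf : Measurable f)
    (hfi : IntegrableOn (fun ω => f (θ ω, x' ω)) A μ) :
    ∫ ω in A, f (θ ω, x' ω) ∂μ = ∫ ω in A, ∫ y, f (θ ω, y) ∂(P (θ ω) (x ω)) ∂μ := by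
  have hp : Measurable fun ω => (θ ω, x ω) := (hθ.prodMk hx).mono hm le_rfl
  have hfm : Measurable fun q : (Θ × X) × X => f (q.1.1, q.2) :=
    hf.comp (measurable_fst.fst.prodMk measurable_snd)
  have key := map_restrict_eq_compProd hP hm hx hθ hx' hMarkov hA
  have hi : Integrable (fun q : (Θ × X) × X => f (q.1.1, q.2))
      ((μ.restrict A).map (fun ω => ((θ ω, x ω), x' ω))) :=
    (integrable_map_measure hfm.aestronglyMeasurable (hp.prodMk hx').aemeasurable).2 hfi
  calc ∫ ω in A, f (θ ω, x' ω) ∂μ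
      = ∫ q, f (q.1.1, q.2) ∂((μ.restrict A).map (fun ω => ((θ ω, x ω), x' ω))) :=
        (integral_map (hp.prodMk hx').aemeasurable hfm.aestronglyMeasurable).symm
    _ = _ := by
        rw [key] at hi ⊢
        rw [Measure.integral_compProd hi, integral_map hp.aemeasurable
          hfm.stronglyMeasurable.integral_kernel_prod_right'.aestronglyMeasurable]
        rfl

/-- Centred functions of the next state have mean zero on events of the past. -/
lemma setIntegral_mul_sub_eq_zero (hP : Measurable fun p : Θ × X => P p.1 p.2) (hm : m ≤ mΩ)
    (hx : Measurable[m] x) (hθ : Measurable[m] θ) (hx' : Measurable x')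
    (hMarkov : ∀ f : X → ℝ, Measurable f → (∃ M : ℝ, ∀ y, |f y| ≤ M) →
      μ[fun ω => f (x' ω) | m] =ᵐ[μ] fun ω => ∫ y, f y ∂(P (θ ω) (x ω)))
    (hA : MeasurableSet[m] A) {f : Θ × X → ℝ} (hf : Measurable f) {z : Ω → ℝ}
    (hz : Measurable[m] z)
    (hfi : ∀ ω ∈ A, Integrable (fun y => f (θ ω, y)) (P (θ ω) (x ω))) :
    ∫ ω in A, z ω * (f (θ ω, x' ω) - ∫ y, f (θ ω, y) ∂(P (θ ω) (x ω))) ∂μ = 0 := by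
  -- Without integrability the Bochner integral is `0` by default, so no moment hypothesis is
  -- required here.
  by_cases hi : IntegrableOn
    (fun ω => z ω * (f (θ ω, x' ω) - ∫ y, f (θ ω, y) ∂(P (θ ω) (x ω)))) A μ
  · have hc : Measurable[m] fun ω => ∫ y, f (θ ω, y) ∂(P (θ ω) (x ω)) :=
      (measurable_integral_family hP hf).comp (hθ.prodMk hx)
    -- The weight `z` and the conditional mean are known from the past, so they are carried as two
    -- extra real coordinates of the parameter.
    have h := setIntegral_transition (P := fun t : Θ × ℝ × ℝ => P t.1)
      (f := fun q => q.1.2.1 * (f (q.1.1, q.2) - q.1.2.2))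
      (hP.comp (measurable_fst.fst.prodMk measurable_snd)) hm hx (hθ.prodMk (hz.prodMk hc)) hx'
      hMarkov hA (measurable_fst.snd.fst.mul
        ((hf.comp (measurable_fst.fst.prodMk measurable_snd)).sub measurable_fst.snd.snd)) hi
    rw [h]
    refine setIntegral_eq_zero_of_forall_eq_zero fun ω hω => ?_
    simp only
    rw [integral_const_mul, integral_sub (hfi ω hω) (integrable_const _)]
    simp
  · exact integral_undef hi

lemma setLIntegral_mul_sub_rpow (hP : Measurable fun p : Θ × X => P p.1 p.2) (hm : m ≤ mΩ)
    (hx : Measurable[m] x) (hθ : Measurable[m] θ) (hx' : Measurable x')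
    (hMarkov : ∀ f : X → ℝ, Measurable f → (∃ M : ℝ, ∀ y, |f y| ≤ M) →
      μ[fun ω => f (x' ω) | m] =ᵐ[μ] fun ω => ∫ y, f y ∂(P (θ ω) (x ω)))
    (hA : MeasurableSet[m] A) {f : Θ × X → ℝ} (hf : Measurable f) {z : Ω → ℝ}
    (hz : Measurable[m] z) (α : ℝ) :
    ∫⁻ ω in A, ‖z ω * (f (θ ω, x' ω) - ∫ y, f (θ ω, y) ∂(P (θ ω) (x ω)))‖ₑ ^ α ∂μ =
      ∫⁻ ω in A, ∫⁻ w, ‖z ω * (f (θ ω, w) - ∫ y, f (θ ω, y) ∂(P (θ ω) (x ω)))‖ₑ ^ α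
        ∂(P (θ ω) (x ω)) ∂μ := by
  have hc : Measurable[m] fun ω => ∫ y, f (θ ω, y) ∂(P (θ ω) (x ω)) :=
    (measurable_integral_family hP hf).comp (hθ.prodMk hx)
  exact setLIntegral_transition (P := fun t : Θ × ℝ × ℝ => P t.1)
    (f := fun q => ‖q.1.2.1 * (f (q.1.1, q.2) - q.1.2.2)‖ₑ ^ α)
    (hP.comp (measurable_fst.fst.prodMk measurable_snd)) hm hx (hθ.prodMk (hz.prodMk hc)) hx'
    hMarkov hA ((measurable_fst.snd.fst.mul ((hf.comp (measurable_fst.fst.prodMk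
      measurable_snd)).sub measurable_fst.snd.snd)).enorm.pow_const α)

end Transition

/-! ### Moment inequalities of order `α`. -/

section Moments

variable {X : Type*} [MeasurableSpace X] {ν : Measure X} [IsProbabilityMeasure ν]

lemma lintegral_enorm_rpow_le {f : X → ℝ} (hf : Measurable f) {α : ℝ} (hα : 1 ≤ α) :
    (∫⁻ y, ‖f y‖ₑ ∂ν) ^ α ≤ ∫⁻ y, ‖f y‖ₑ ^ α ∂ν := by
  have hα0 : 0 < α := by linarith
  have h := eLpNorm_le_eLpNorm_of_exponent_le (μ := ν) (p := 1) (q := ENNReal.ofReal α)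
    (by rwa [← ENNReal.ofReal_one, ENNReal.ofReal_le_ofReal_iff hα0.le]) hf.aestronglyMeasurable
  rw [eLpNorm_one_eq_lintegral_enorm, eLpNorm_eq_lintegral_rpow_enorm_toReal (by simpa using hα0)
    ENNReal.ofReal_ne_top, ENNReal.toReal_ofReal hα0.le] at h
  have h2 := ENNReal.rpow_le_rpow h hα0.le
  rwa [← ENNReal.rpow_mul, one_div_mul_cancel hα0.ne', ENNReal.rpow_one] at h2

lemma integrable_of_lintegral_rpow_lt_top {f : X → ℝ} (hf : Measurable f) {α : ℝ} (hα : 1 ≤ α)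
    (h : ∫⁻ y, ‖f y‖ₑ ^ α ∂ν < ∞) : Integrable f ν := by
  refine ⟨hf.aestronglyMeasurable, ?_⟩
  have := (lintegral_enorm_rpow_le (ν := ν) hf hα).trans_lt h
  exact (ENNReal.rpow_lt_top_iff_of_pos (by linarith)).1 this

lemma lintegral_mul_sub_integral_rpow_le {f : X → ℝ} (hf : Measurable f) {α : ℝ} (hα : 1 ≤ α)
    (z : ℝ) :
    ∫⁻ w, ‖z * (f w - ∫ y, f y ∂ν)‖ₑ ^ α ∂ν ≤
      ‖z‖ₑ ^ α * (2 ^ α * ∫⁻ y, ‖f y‖ₑ ^ α ∂ν) := by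
  have hα0 : 0 ≤ α := by linarith
  have hmean : ‖∫ y, f y ∂ν‖ₑ ^ α ≤ ∫⁻ y, ‖f y‖ₑ ^ α ∂ν :=
    (ENNReal.rpow_le_rpow (enorm_integral_le_lintegral_enorm f) hα0).trans
      (lintegral_enorm_rpow_le hf hα)
  have hm : Measurable fun y => ‖f y‖ₑ ^ α := hf.enorm.pow_const α
  calc ∫⁻ w, ‖z * (f w - ∫ y, f y ∂ν)‖ₑ ^ α ∂ν
      ≤ ∫⁻ w, ‖z‖ₑ ^ α * (2 ^ (α - 1) * (‖f w‖ₑ ^ α + ‖∫ y, f y ∂ν‖ₑ ^ α)) ∂ν := by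
        refine lintegral_mono fun w => ?_
        rw [enorm_mul, ENNReal.mul_rpow_of_nonneg _ _ hα0]
        gcongr
        exact (ENNReal.rpow_le_rpow (enorm_sub_le) hα0).trans
          (ENNReal.rpow_add_le_mul_rpow_add_rpow _ _ hα)
    _ = ‖z‖ₑ ^ α * (2 ^ (α - 1) * (∫⁻ w, ‖f w‖ₑ ^ α ∂ν + ‖∫ y, f y ∂ν‖ₑ ^ α)) := by
        rw [lintegral_const_mul _ ((hm.add_const _).const_mul _),
          lintegral_const_mul _ (hm.add_const _), lintegral_add_left hm]
        simp
    _ ≤ ‖z‖ₑ ^ α * (2 ^ (α - 1) * (∫⁻ w, ‖f w‖ₑ ^ α ∂ν + ∫⁻ w, ‖f w‖ₑ ^ α ∂ν)) := by gcongr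
    _ = _ := by
        rw [← two_mul, ← mul_assoc (2 ^ (α - 1) : ℝ≥0∞)]
        congr 2
        nth_rewrite 2 [← ENNReal.rpow_one 2]
        rw [← ENNReal.rpow_add _ _ two_ne_zero ENNReal.ofNat_ne_top]
        congr 1
        ring

end Moments

/-! ### Martingale convergence by localization. -/

section Convergence

variable {Ω : Type*} {mΩ : MeasurableSpace Ω} {μ : Measure Ω} [IsProbabilityMeasure μ]
  {𝒢 : Filtration ℕ mΩ}

/-- Only the last index `k` with `ω ∈ A k` matters: the bound there already covers all earlier
terms. -/
lemma sum_indicator_le_of_forall_mem {J : ℕ → Ω → ℝ≥0∞} {A : ℕ → Set Ω} {B : ℝ≥0∞}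
    (hA : ∀ k, ∀ ω ∈ A k, ∑ j ∈ Finset.range (k + 1), J j ω ≤ B) (n : ℕ) (ω : Ω) :
    ∑ k ∈ Finset.range n, (A k).indicator (J k) ω ≤ B := by
  induction n with
  | zero => simp
  | succ n ih =>
    by_cases hω : ω ∈ A n
    · exact (Finset.sum_le_sum fun k _ => Set.indicator_le_self _ _ _).trans (hA n ω hω)
    · rw [Finset.sum_range_succ, Set.indicator_of_notMem hω, add_zero]
      exact ih

/-- If the compensators `J k` of nonnegative variables `y k` are summable, so are the `y k`. -/
lemma ae_tsum_lt_top_of_compensator {y J : ℕ → Ω → ℝ≥0∞} (hy : ∀ k, Measurable (y k))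
    (hJ : ∀ k, Measurable[𝒢 k] (J k))
    (hle : ∀ k A, MeasurableSet[𝒢 k] A → ∫⁻ ω in A, y k ω ∂μ ≤ ∫⁻ ω in A, J k ω ∂μ)
    (hsum : ∀ᵐ ω ∂μ, ∑' k, J k ω < ∞) : ∀ᵐ ω ∂μ, ∑' k, y k ω < ∞ := by
  have hJ' (k : ℕ) : Measurable (J k) := (hJ k).mono (𝒢.le k) le_rfl
  -- The compensator is predictable, so its `k`-th term can be included in the stopping rule for the
  -- `k`-th step; the stopped compensator then never exceeds `B`.
  let A (B k : ℕ) : Set Ω := {ω | ∑ j ∈ Finset.range (k + 1), J j ω ≤ B}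
  have hAm (B k : ℕ) : MeasurableSet[𝒢 k] (A B k) :=
    measurableSet_le (Finset.measurable_fun_sum _ fun j hj =>
      (hJ j).mono (𝒢.mono (Finset.mem_range_succ_iff.1 hj)) le_rfl) measurable_const
  have hAm' (B k : ℕ) : MeasurableSet (A B k) := 𝒢.le k _ (hAm B k)
  have hfin (B : ℕ) : ∀ᵐ ω ∂μ, ∑' k, (A B k).indicator (y k) ω < ∞ := by
    refine ae_lt_top (Measurable.tsum fun k => (hy k).indicator (hAm' B k)) ?_
    rw [lintegral_tsum fun k => ((hy k).indicator (hAm' B k)).aemeasurable]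
    refine ne_of_lt (lt_of_le_of_lt ?_ (ENNReal.natCast_lt_top B))
    calc ∑' k, ∫⁻ ω, (A B k).indicator (y k) ω ∂μ
        ≤ ∑' k, ∫⁻ ω, (A B k).indicator (J k) ω ∂μ := by
          refine ENNReal.tsum_le_tsum fun k => ?_
          rw [lintegral_indicator (hAm' B k), lintegral_indicator (hAm' B k)]
          exact hle k _ (hAm B k)
      _ = ∫⁻ ω, ∑' k, (A B k).indicator (J k) ω ∂μ :=
          (lintegral_tsum fun k => ((hJ' k).indicator (hAm' B k)).aemeasurable).symm
      _ ≤ ∫⁻ _, B ∂μ := by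
          refine lintegral_mono fun ω => ?_
          rw [ENNReal.tsum_eq_iSup_nat]
          exact iSup_le fun n => sum_indicator_le_of_forall_mem (fun k ω h => h) n ω
      _ = B := by simp
  filter_upwards [hsum, ae_all_iff.2 hfin] with ω h1 h2
  obtain ⟨B, hB⟩ := ENNReal.exists_nat_gt h1.ne
  have hmem (k : ℕ) : ω ∈ A B k := (ENNReal.sum_le_tsum _).trans hB.le
  simpa only [Set.indicator_of_mem (hmem _)] using h2 B

/-- A sum of martingale differences that is bounded below converges, if the compensators `J k` of
the `α`-th powers of the differences are summable. -/
lemma ae_exists_tendsto_of_bddBelow {ξ : ℕ → Ω → ℝ} {J : ℕ → Ω → ℝ≥0∞} {α : ℝ} (hα : 1 ≤ α)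
    (hξ : ∀ k, Measurable[𝒢 (k + 1)] (ξ k)) (hJ : ∀ k, Measurable[𝒢 k] (J k))
    (hle : ∀ k A, MeasurableSet[𝒢 k] A →
      ∫⁻ ω in A, ENNReal.ofReal (|ξ k ω| ^ α) ∂μ ≤ ∫⁻ ω in A, J k ω ∂μ)
    (hzero : ∀ k A, MeasurableSet[𝒢 k] A → ∀ B : ℕ, (∀ ω ∈ A, J k ω ≤ B) →
      ∫ ω in A, ξ k ω ∂μ = 0)
    (hsum : ∀ᵐ ω ∂μ, ∑' k, J k ω < ∞)
    (hbdd : ∀ᵐ ω ∂μ, ∃ c : ℝ, ∀ n, c ≤ ∑ k ∈ Finset.range n, ξ k ω) :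
    ∀ᵐ ω ∂μ, ∃ l, Tendsto (fun n => ∑ k ∈ Finset.range n, ξ k ω) atTop (𝓝 l) := by
  have hJ' (k : ℕ) : Measurable (J k) := (hJ k).mono (𝒢.le k) le_rfl
  have hξ' (k : ℕ) : Measurable (ξ k) := (hξ k).mono (𝒢.le _) le_rfl
  -- The `k`-th step is kept while the compensator is at most `B` and no partial sum before the step
  -- has fallen below `-B`. These events decrease in `k`, and almost every path stays in all of them
  -- for some `B`.
  let A (B k : ℕ) : Set Ω := {ω | ∑ j ∈ Finset.range (k + 1), J j ω ≤ B} ∩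
    ⋂ m ∈ Finset.range (k + 1), {ω | -(B : ℝ) ≤ ∑ j ∈ Finset.range m, ξ j ω}
  have hAm (B k : ℕ) : MeasurableSet[𝒢 k] (A B k) := by
    refine MeasurableSet.inter (measurableSet_le (Finset.measurable_fun_sum _ fun j hj =>
      (hJ j).mono (𝒢.mono (Finset.mem_range_succ_iff.1 hj)) le_rfl) measurable_const) ?_
    refine Finset.measurableSet_biInter _ fun m hm => ?_
    refine measurableSet_le measurable_const (Finset.measurable_fun_sum _ fun j hj =>
      (hξ j).mono (𝒢.mono ?_) le_rfl)
    rw [Finset.mem_range] at hm hj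
    omega
  have hAm' (B k : ℕ) : MeasurableSet (A B k) := 𝒢.le k _ (hAm B k)
  have hA1 (B k : ℕ) : ∀ ω ∈ A B k, ∑ j ∈ Finset.range (k + 1), J j ω ≤ B := fun ω h => h.1
  have hA2 (B k : ℕ) (ω : Ω) (h : ω ∈ A B k) (m : ℕ) (hm : m ≤ k) :
      -(B : ℝ) ≤ ∑ j ∈ Finset.range m, ξ j ω := by
    have := Set.mem_iInter₂.1 h.2 m (Finset.mem_range_succ_iff.2 hm)
    exact this
  have hAanti (B j k : ℕ) (hjk : j ≤ k) (ω : Ω) (h : ω ∈ A B k) : ω ∈ A B j := by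
    refine ⟨?_, Set.mem_iInter₂.2 fun m hm => hA2 B k ω h m ?_⟩
    · refine le_trans (Finset.sum_le_sum_of_subset ?_) (hA1 B k ω h)
      exact Finset.range_subset_range.2 (by omega)
    · rw [Finset.mem_range] at hm; omega
  have hJle (B k : ℕ) (ω : Ω) (h : ω ∈ A B k) : J k ω ≤ B :=
    (Finset.single_le_sum (f := fun j => J j ω) (fun _ _ => zero_le)
      (Finset.self_mem_range_succ k)).trans (hA1 B k ω h)
  let Y (B k : ℕ) (ω : Ω) : ℝ := (A B k).indicator (fun ω => |ξ k ω| ^ α) ω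
  have hYm (B k : ℕ) : Measurable (Y B k) :=
    ((hξ' k).abs.pow_const α).indicator (hAm' B k)
  have hY0 (B k : ℕ) (ω : Ω) : 0 ≤ Y B k ω :=
    Set.indicator_nonneg (fun ω _ => by positivity) ω
  have hYlint (B k : ℕ) : ∫⁻ ω, ENNReal.ofReal (Y B k ω) ∂μ ≤
      ∫⁻ ω, (A B k).indicator (J k) ω ∂μ := by
    have : (fun ω => ENNReal.ofReal (Y B k ω)) =
        (A B k).indicator fun ω => ENNReal.ofReal (|ξ k ω| ^ α) := by
      funext ω
      by_cases hω : ω ∈ A B k <;> simp [Y, hω]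
    rw [this, lintegral_indicator (hAm' B k), lintegral_indicator (hAm' B k)]
    exact hle k _ (hAm B k)
  have hYsum (B n : ℕ) : ∫⁻ ω, ENNReal.ofReal (∑ k ∈ Finset.range n, Y B k ω) ∂μ ≤ B := by
    simp_rw [ENNReal.ofReal_sum_of_nonneg fun k _ => hY0 B k _]
    rw [lintegral_finsetSum _ fun k _ => (hYm B k).ennreal_ofReal]
    calc ∑ k ∈ Finset.range n, ∫⁻ ω, ENNReal.ofReal (Y B k ω) ∂μ
        ≤ ∑ k ∈ Finset.range n, ∫⁻ ω, (A B k).indicator (J k) ω ∂μ :=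
          Finset.sum_le_sum fun k _ => hYlint B k
      _ = ∫⁻ ω, ∑ k ∈ Finset.range n, (A B k).indicator (J k) ω ∂μ :=
          (lintegral_finsetSum _ fun k _ => (hJ' k).indicator (hAm' B k)).symm
      _ ≤ ∫⁻ _, B ∂μ := lintegral_mono fun ω => sum_indicator_le_of_forall_mem (hA1 B) n ω
      _ = B := by simp
  have hYsm (B n : ℕ) : Measurable fun ω => ∑ k ∈ Finset.range n, Y B k ω :=
    Finset.measurable_fun_sum _ fun k _ => hYm B k
  have hYs0 (B n : ℕ) (ω : Ω) : 0 ≤ ∑ k ∈ Finset.range n, Y B k ω :=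
    Finset.sum_nonneg fun k _ => hY0 B k ω
  have hYsi (B n : ℕ) : Integrable (fun ω => ∑ k ∈ Finset.range n, Y B k ω) μ := by
    refine ⟨(hYsm B n).aestronglyMeasurable, ?_⟩
    rw [hasFiniteIntegral_iff_ofReal (Eventually.of_forall (hYs0 B n))]
    exact (hYsum B n).trans_lt (ENNReal.natCast_lt_top B)
  have hYint (B n : ℕ) : ∫ ω, ∑ k ∈ Finset.range n, Y B k ω ∂μ ≤ B := by
    rw [integral_eq_lintegral_of_nonneg_ae (Eventually.of_forall (hYs0 B n))
      (hYsm B n).aestronglyMeasurable]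
    exact ENNReal.toReal_le_of_le_ofReal (Nat.cast_nonneg B) (by simpa using hYsum B n)
  have hpow (k : ℕ) (ω : Ω) : |ξ k ω| ≤ 1 + |ξ k ω| ^ α := by
    rcases le_total |ξ k ω| 1 with h1 | h1
    · have : 0 ≤ |ξ k ω| ^ α := by positivity
      linarith
    · have := Real.rpow_le_rpow_of_exponent_le h1 hα
      rw [Real.rpow_one] at this
      linarith
  let N (B n : ℕ) (ω : Ω) : ℝ := ∑ k ∈ Finset.range n, (A B k).indicator (ξ k) ω
  have hξi (B k : ℕ) : Integrable ((A B k).indicator (ξ k)) μ := by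
    have hYi : Integrable (Y B k) μ := by
      refine ⟨(hYm B k).aestronglyMeasurable, ?_⟩
      rw [hasFiniteIntegral_iff_ofReal (Eventually.of_forall (hY0 B k))]
      refine (hYlint B k).trans_lt (lt_of_le_of_lt (lintegral_mono (g := fun _ => (B : ℝ≥0∞))
        fun ω => ?_) (by simp))
      exact Set.indicator_le' (fun ω h => hJle B k ω h) (fun _ _ => zero_le) ω
    refine ((integrable_const (1 : ℝ)).add hYi).mono'
      ((hξ' k).indicator (hAm' B k)).aestronglyMeasurable (Eventually.of_forall fun ω => ?_)
    by_cases hω : ω ∈ A B k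
    · simpa [Y, hω] using hpow k ω
    · simp [Y, hω]
  have hNm (B n : ℕ) : Measurable[𝒢 n] (N B n) :=
    Finset.measurable_fun_sum _ fun k hk => by
      have hkn := Finset.mem_range.1 hk
      exact ((hξ k).mono (𝒢.mono hkn) le_rfl).indicator (𝒢.mono hkn.le _ (hAm B k))
  have hNi (B n : ℕ) : Integrable (N B n) μ := integrable_finsetSum _ fun k _ => hξi B k
  have hstep (B n : ℕ) (s : Set Ω) (hs : MeasurableSet[𝒢 n] s) :
      ∫ ω in s, N B n ω ∂μ = ∫ ω in s, N B (n + 1) ω ∂μ := by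
    simp only [N, Finset.sum_range_succ]
    rw [integral_add (hNi B n).integrableOn (hξi B n).integrableOn,
      setIntegral_indicator (hAm' B n),
      hzero n _ (hs.inter (hAm B n)) B fun ω h => hJle B n ω h.2, add_zero]
  have hmart (B : ℕ) : Martingale (N B) 𝒢 μ :=
    martingale_of_setIntegral_eq_succ (fun n => (hNm B n).stronglyMeasurable) (hNi B)
      fun n s hs => hstep B n s hs
  -- Before the last retained step the sum is at least `-B`; that step can overshoot by at most `|ξ|
  -- ≤ 1 + |ξ|^α`, and `Y` collects these powers.
  have hlow (B n : ℕ) (ω : Ω) : -(B + 1 + ∑ k ∈ Finset.range n, Y B k ω) ≤ N B n ω := by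
    induction n with
    | zero =>
      have : (0 : ℝ) ≤ B := Nat.cast_nonneg B
      simp only [N, Finset.range_zero, Finset.sum_empty]
      linarith
    | succ n ih =>
      by_cases hω : ω ∈ A B n
      · have h1 : N B n ω = ∑ k ∈ Finset.range n, ξ k ω :=
          Finset.sum_congr rfl fun k hk => Set.indicator_of_mem
            (hAanti B k n (Finset.mem_range.1 hk).le ω hω) _
        have h2 := hA2 B n ω hω n le_rfl
        have h3 := hpow n ω
        have h4 := hYs0 B n ω
        have h5 := neg_abs_le (ξ n ω)
        simp only [N] at h1 ⊢
        rw [Finset.sum_range_succ, Finset.sum_range_succ, h1, Set.indicator_of_mem hω]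
        simp only [Y, Set.indicator_of_mem hω] at h4 ⊢
        linarith
      · simp only [N, Y] at ih ⊢
        rw [Finset.sum_range_succ, Finset.sum_range_succ, Set.indicator_of_notMem hω,
          Set.indicator_of_notMem hω]
        simpa using ih
  have hN0 (B n : ℕ) : ∫ ω, N B n ω ∂μ = 0 := by
    induction n with
    | zero => simp [N]
    | succ n ih =>
      have := hstep B n Set.univ MeasurableSet.univ
      simp only [Measure.restrict_univ] at this
      rw [← this, ih]
  -- A mean-zero variable with an integrable lower bound `-G`, `G ≥ 0`, satisfies `E|N| ≤ 2 E G`,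
  -- since `|N| ≤ N + 2G`. Here `E G ≤ 2B + 1`.
  have hL1 (B n : ℕ) : eLpNorm (N B n) 1 μ ≤ ((4 * B + 2 : ℕ) : NNReal) := by
    rw [eLpNorm_one_eq_lintegral_enorm, ← ofReal_integral_norm_eq_lintegral_enorm (hNi B n)]
    have hb : ∫ ω, ‖N B n ω‖ ∂μ ≤ 4 * B + 2 := by
      calc ∫ ω, ‖N B n ω‖ ∂μ
          ≤ ∫ ω, (N B n ω + 2 * (B + 1 + ∑ k ∈ Finset.range n, Y B k ω)) ∂μ := by
            refine integral_mono (hNi B n).norm ((hNi B n).add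
              (((integrable_const _).add (hYsi B n)).const_mul 2)) fun ω => ?_
            have h1 := hlow B n ω
            have h2 := hYs0 B n ω
            have h3 : (0 : ℝ) ≤ B := Nat.cast_nonneg B
            simp only [Real.norm_eq_abs]
            rcases abs_cases (N B n ω) with ⟨h, _⟩ | ⟨h, _⟩ <;> rw [h] <;> linarith
        _ = 2 * (B + 1 + ∫ ω, ∑ k ∈ Finset.range n, Y B k ω ∂μ) := by
            have h1 : Integrable (fun ω => (B + 1 : ℝ) + ∑ k ∈ Finset.range n, Y B k ω) μ :=
              (integrable_const _).add (hYsi B n)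
            rw [integral_add (hNi B n) (h1.const_mul 2), hN0, integral_const_mul,
              integral_add (integrable_const _) (hYsi B n)]
            simp
        _ ≤ 4 * B + 2 := by linarith [hYint B n]
    refine (ENNReal.ofReal_le_ofReal hb).trans (le_of_eq ?_)
    rw [show (4 * (B : ℝ) + 2) = ((4 * B + 2 : ℕ) : ℝ) by push_cast; ring, ENNReal.ofReal_natCast]
    simp
  filter_upwards [hsum, hbdd, ae_all_iff.2 fun B =>
    (hmart B).submartingale.exists_ae_tendsto_of_bdd (hL1 B)] with ω h1 ⟨c, hc⟩ h3
  obtain ⟨B₁, hB₁⟩ := ENNReal.exists_nat_gt h1.ne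
  obtain ⟨B₂, hB₂⟩ := exists_nat_ge (-c)
  have hmem (k : ℕ) : ω ∈ A (max B₁ B₂) k := by
    refine ⟨(ENNReal.sum_le_tsum _).trans (hB₁.le.trans (by exact_mod_cast le_max_left _ _)),
      Set.mem_iInter₂.2 fun m _ => ?_⟩
    have h4 := hc m
    have h5 : (B₂ : ℝ) ≤ (max B₁ B₂ : ℕ) := by exact_mod_cast le_max_right _ _
    change -((max B₁ B₂ : ℕ) : ℝ) ≤ ∑ j ∈ Finset.range m, ξ j ω
    linarith
  simpa only [N, Set.indicator_of_mem (hmem _)] using h3 (max B₁ B₂)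

end Convergence

/-! ### The Lyapunov function and its one-step inequality. -/

section Lyapunov

/-- `a - η`, truncated to `[0, 1]`. -/
noncomputable def clampAbove (η a : ℝ) : ℝ := max 0 (min 1 (a - η))

lemma clampAbove_nonneg (η a : ℝ) : 0 ≤ clampAbove η a := le_max_left _ _

lemma clampAbove_le_one (η a : ℝ) : clampAbove η a ≤ 1 :=
  max_le zero_le_one (min_le_left _ _)

lemma clampAbove_mono (η : ℝ) : Monotone (clampAbove η) := fun a b hab =>
  max_le_max le_rfl (min_le_min le_rfl (by linarith))

lemma continuous_clampAbove (η : ℝ) : Continuous (clampAbove η) := by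
  unfold clampAbove; fun_prop

lemma clampAbove_eq_zero {η a : ℝ} (h : a ≤ η) : clampAbove η a = 0 :=
  max_eq_left ((min_le_right _ _).trans (by linarith))

lemma clampAbove_eq_one {η a : ℝ} (h : η + 1 ≤ a) : clampAbove η a = 1 := by
  rw [clampAbove, min_eq_left (by linarith), max_eq_right zero_le_one]

lemma clampAbove_pos {η a : ℝ} (h : η < a) : 0 < clampAbove η a :=
  lt_max_of_lt_right (lt_min one_pos (by linarith))

lemma clampAbove_sub_le {η a b : ℝ} (h : a ≤ b) : clampAbove η b - clampAbove η a ≤ b - a := by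
  unfold clampAbove
  rcases max_cases 0 (min 1 (b - η)) with h1 | h1 <;>
  rcases max_cases 0 (min 1 (a - η)) with h2 | h2 <;>
  rcases min_cases 1 (b - η) with h3 | h3 <;>
  rcases min_cases 1 (a - η) with h4 | h4 <;> linarith

/-- A convex primitive of `clampAbove η ^ r`. -/
noncomputable def lyapunov (η : ℝ) (r : ℕ) (a : ℝ) : ℝ := ∫ z in (0 : ℝ)..a, clampAbove η z ^ r

/-- Convexity, with the slope at the endpoint `y` rather than at `x`: for averages, `y` is known
before the noise that it multiplies. -/
lemma lyapunov_sub_le (η : ℝ) (r : ℕ) (x y : ℝ) :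
    lyapunov η r y - lyapunov η r x ≤ clampAbove η y ^ r * (y - x) := by
  have hc : Continuous fun z => clampAbove η z ^ r := (continuous_clampAbove η).pow r
  have hi (a b : ℝ) : IntervalIntegrable (fun z => clampAbove η z ^ r) volume a b :=
    hc.intervalIntegrable a b
  have hmono {a b : ℝ} (hab : a ≤ b) : clampAbove η a ^ r ≤ clampAbove η b ^ r :=
    pow_le_pow_left₀ (clampAbove_nonneg _ _) (clampAbove_mono η hab) r
  rw [lyapunov, lyapunov, intervalIntegral.integral_interval_sub_left (hi _ _) (hi _ _)]
  rcases le_total x y with hxy | hxy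
  · have := intervalIntegral.integral_mono_on hxy (hi x y) intervalIntegrable_const
      fun z hz => hmono hz.2
    rw [intervalIntegral.integral_const, smul_eq_mul] at this
    linarith
  · have := intervalIntegral.integral_mono_on hxy intervalIntegrable_const (hi y x)
      fun z hz => hmono hz.1
    rw [intervalIntegral.integral_const, smul_eq_mul] at this
    rw [intervalIntegral.integral_symm]
    linarith

lemma lyapunov_mono (η : ℝ) (r : ℕ) : Monotone (lyapunov η r) := fun x y hxy => by
  have := lyapunov_sub_le η r y x
  have h2 := pow_nonneg (clampAbove_nonneg η x) r
  nlinarith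

lemma lyapunov_eq_zero {η a : ℝ} {r : ℕ} (hη : 0 ≤ η) (hr : r ≠ 0) (h : a ≤ η) :
    lyapunov η r a = 0 := by
  have h0 : lyapunov η r 0 = 0 := intervalIntegral.integral_same
  have h1 := lyapunov_sub_le η r 0 a
  have h2 := lyapunov_sub_le η r a 0
  rw [clampAbove_eq_zero h, zero_pow hr] at h1
  rw [clampAbove_eq_zero hη, zero_pow hr] at h2
  linarith

lemma lyapunov_nonneg {η : ℝ} {r : ℕ} (hη : 0 ≤ η) (hr : r ≠ 0) (a : ℝ) : 0 ≤ lyapunov η r a := by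
  rcases le_total a η with h | h
  · exact (lyapunov_eq_zero hη hr h).ge
  · rw [← lyapunov_eq_zero hη hr le_rfl]
    exact lyapunov_mono η r h

lemma lyapunov_pos {η a : ℝ} {r : ℕ} (hη : 0 ≤ η) (hr : r ≠ 0) (h : η < a) :
    0 < lyapunov η r a := by
  have h1 := lyapunov_sub_le η r a ((η + a) / 2)
  have h2 := lyapunov_nonneg hη hr ((η + a) / 2)
  have h3 : 0 < clampAbove η ((η + a) / 2) ^ r := pow_pos (clampAbove_pos (by linarith)) r
  nlinarith

/-- Second-order error of `s ^ r` along a step `|s' - s| ≤ w + b / n`, multiplied by `u ≤ U`; the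
term `c s ^ r w` can be absorbed. -/
lemma exists_abs_pow_sub_pow_mul_le {r : ℕ} (hr : r ≠ 0) {b c : ℝ} (hb : 0 ≤ b) (hc : 0 < c) :
    ∃ K : ℝ, 0 ≤ K ∧ ∀ s s' u w U n : ℝ, 0 ≤ s → s ≤ 1 → 0 ≤ s' → s' ≤ 1 → 0 ≤ u → u ≤ U →
      0 ≤ w → w ≤ U → 0 < n → |s' - s| ≤ w + b / n →
      |s' ^ r - s ^ r| * u ≤ c * s ^ r * w + K * (U ^ (r + 1) + U / n) := by
  obtain ⟨q, rfl⟩ := Nat.exists_eq_succ_of_ne_zero hr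
  set R : ℝ := (q + 1) * 2 ^ q with hR
  have hRpos : 0 < R := by positivity
  -- `R` is the constant in `|s'^(q+1) - s^(q+1)| ≤ R (s^q δ + δ^(q+1))`; dividing by it leaves
  -- exactly `c` in front of the term to be absorbed.
  set c' := c / R with hc'
  have hc'pos : 0 < c' := by positivity
  refine ⟨R * ((1 / c') ^ q + 2 ^ (q + 1)) + R * (3 * b), by positivity, ?_⟩
  intro s s' u w U n hs hs1 hs' hs1' hu huU hw hwU hn hδ
  set δ := |s' - s| with hδdef
  have hδ0 : 0 ≤ δ := abs_nonneg _
  have hδ1 : δ ≤ 1 := abs_le.2 ⟨by linarith, by linarith⟩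
  have hU : 0 ≤ U := hu.trans huU
  have hbn : 0 ≤ b / n := by positivity
  have hdiff : |s' ^ (q + 1) - s ^ (q + 1)| ≤ R * (s ^ q * δ + δ ^ (q + 1)) := by
    have h1 : |s' ^ (q + 1) - s ^ (q + 1)| ≤ δ * (q + 1 : ℕ) * max |s'| |s| ^ q :=
      abs_pow_sub_pow_le s' s (q + 1)
    have hmax : max |s'| |s| ≤ s + δ := by
      rw [abs_of_nonneg hs, abs_of_nonneg hs']
      refine max_le ?_ (by linarith)
      linarith [le_abs_self (s' - s)]
    have hpow : max |s'| |s| ^ q ≤ 2 ^ q * (s ^ q + δ ^ q) := by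
      have h2 : max |s'| |s| ^ q ≤ (s + δ) ^ q := by gcongr
      refine h2.trans ?_
      rcases le_total δ s with h | h
      · calc (s + δ) ^ q ≤ (2 * s) ^ q := by gcongr; linarith
          _ = 2 ^ q * s ^ q := mul_pow _ _ _
          _ ≤ _ := by gcongr; linarith [pow_nonneg hδ0 q]
      · calc (s + δ) ^ q ≤ (2 * δ) ^ q := by gcongr; linarith
          _ = 2 ^ q * δ ^ q := mul_pow _ _ _
          _ ≤ _ := by gcongr; linarith [pow_nonneg hs q]
    calc |s' ^ (q + 1) - s ^ (q + 1)| ≤ δ * (q + 1 : ℕ) * max |s'| |s| ^ q := h1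
      _ ≤ δ * (q + 1 : ℕ) * (2 ^ q * (s ^ q + δ ^ q)) := by gcongr
      _ = _ := by rw [hR]; push_cast; ring
  -- A Young inequality by cases: either `u` is small against `s`, or `s` is bounded by a multiple
  -- of `U`.
  have hyoung : s ^ q * u ≤ c' * s ^ (q + 1) + (1 / c') ^ q * U ^ (q + 1) := by
    rcases le_total u (c' * s) with h | h
    · calc s ^ q * u ≤ s ^ q * (c' * s) := by gcongr
        _ = c' * s ^ (q + 1) := by ring
        _ ≤ _ := le_add_of_nonneg_right (by positivity)
    · have : s ≤ 1 / c' * U := by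
        rw [one_div, ← div_eq_inv_mul, le_div_iff₀ hc'pos]
        linarith
      calc s ^ q * u ≤ (1 / c' * U) ^ q * U := by gcongr
        _ = (1 / c') ^ q * U ^ (q + 1) := by rw [mul_pow]; ring
        _ ≤ _ := le_add_of_nonneg_left (by positivity)
  have h1 : s ^ q * δ * u ≤ c' * s ^ (q + 1) * w + (1 / c') ^ q * U ^ (q + 2) + b * (U / n) := by
    calc s ^ q * δ * u ≤ s ^ q * (w + b / n) * u := by gcongr
      _ = s ^ q * u * w + s ^ q * (b / n) * u := by ring
      _ ≤ (c' * s ^ (q + 1) + (1 / c') ^ q * U ^ (q + 1)) * w + 1 * (b / n) * U := by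
          gcongr
          exact pow_le_one₀ hs hs1
      _ = c' * s ^ (q + 1) * w + (1 / c') ^ q * U ^ (q + 1) * w + b * (U / n) := by ring
      _ ≤ c' * s ^ (q + 1) * w + (1 / c') ^ q * U ^ (q + 1) * U + b * (U / n) := by gcongr
      _ = _ := by ring
  have h2 : δ ^ (q + 1) * u ≤ 2 ^ (q + 1) * U ^ (q + 2) + 2 * b * (U / n) := by
    rcases le_total w (b / n) with h | h
    · calc δ ^ (q + 1) * u ≤ δ * U := by
            gcongr
            exact pow_le_of_le_one hδ0 hδ1 (Nat.succ_ne_zero q)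
        _ ≤ (2 * (b / n)) * U := by gcongr; linarith
        _ = 2 * b * (U / n) := by ring
        _ ≤ _ := le_add_of_nonneg_left (by positivity)
    · calc δ ^ (q + 1) * u ≤ (2 * U) ^ (q + 1) * U := by gcongr; linarith
        _ = 2 ^ (q + 1) * U ^ (q + 2) := by rw [mul_pow]; ring
        _ ≤ _ := le_add_of_nonneg_right (by positivity)
  have hUn : 0 ≤ U / n := by positivity
  have hUp : 0 ≤ U ^ (q + 2) := by positivity
  have e1 : 0 ≤ R * ((1 / c') ^ q + 2 ^ (q + 1)) := by positivity
  have e2 : 0 ≤ R * (3 * b) := by positivity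
  have hRc : R * c' = c := by rw [hc']; field_simp
  calc |s' ^ (q + 1) - s ^ (q + 1)| * u ≤ R * (s ^ q * δ + δ ^ (q + 1)) * u := by gcongr
    _ = R * (s ^ q * δ * u + δ ^ (q + 1) * u) := by ring
    _ ≤ R * ((c' * s ^ (q + 1) * w + (1 / c') ^ q * U ^ (q + 2) + b * (U / n)) +
        (2 ^ (q + 1) * U ^ (q + 2) + 2 * b * (U / n))) := by gcongr
    _ = R * c' * s ^ (q + 1) * w + (R * ((1 / c') ^ q + 2 ^ (q + 1)) * U ^ (q + 2) +
        R * (3 * b) * (U / n)) := by ring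
    _ ≤ c * s ^ (q + 1) * w + (R * ((1 / c') ^ q + 2 ^ (q + 1)) + R * (3 * b)) *
        (U ^ (q + 2) + U / n) := by
      rw [hRc]
      nlinarith [mul_nonneg e1 hUn, mul_nonneg e2 hUp]

/-- The increment of the average contains `-y / n`, which is unbounded in `y`. Truncation removes
it: below `η` and above `η + 1` a move away from the interval is invisible, and otherwise the sign
or the size of `y` helps. -/
lemma abs_clampAbove_sub_le {η σ v p B n x y : ℝ} (hη : 0 < η) (hσ : |σ| = 1) (hv : 0 ≤ v)
    (hp : 0 ≤ p) (hpB : p ≤ B) (hn : 0 < n) (hxy : n * (y - x) = σ * (v - p) - y) :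
    |clampAbove η x - clampAbove η y| ≤ v / n + (B + η + 1) / n := by
  have hΔ : |σ * (v - p)| ≤ v + B := by
    rw [abs_mul, hσ, one_mul]
    exact abs_le.2 ⟨by linarith, by linarith⟩
  have hΔ' := abs_le.1 hΔ
  rw [← add_div]
  have hpos : 0 ≤ (v + (B + η + 1)) / n := by
    have : 0 ≤ B := hp.trans hpB
    positivity
  rcases le_total x y with h | h
  · rw [abs_sub_comm, abs_of_nonneg (sub_nonneg.2 (clampAbove_mono η h))]
    rcases le_total y η with hy | hy
    · rwa [clampAbove_eq_zero hy, clampAbove_eq_zero (h.trans hy), sub_zero]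
    · refine (clampAbove_sub_le h).trans ?_
      rw [le_div_iff₀ hn]
      nlinarith
  · rw [abs_of_nonneg (sub_nonneg.2 (clampAbove_mono η h))]
    rcases le_total (η + 1) y with hy | hy
    · rwa [clampAbove_eq_one hy, clampAbove_eq_one (hy.trans h), sub_self]
    · refine (clampAbove_sub_le h).trans ?_
      rw [le_div_iff₀ hn]
      nlinarith

/-- One step of the Lyapunov function along averages `a ↦ a + (σ Δ - a) / n`. -/
lemma exists_lyapunov_step {r : ℕ} (hr : r ≠ 0) {η B c : ℝ} (hη : 0 < η) (hB : 0 ≤ B) (hc : 0 < c)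
    (hc4 : c ≤ 1 / 4) (hcB : c * B ≤ η / 4) :
    ∃ K : ℝ, 0 ≤ K ∧ ∀ σ v p h h' e m n x y U : ℝ, |σ| = 1 → 0 ≤ v → 0 ≤ p → p ≤ B → 0 < n →
      v - p = e + h - m → n * (y - x) = σ * (v - p) - y → |h| / n ≤ U → v / n ≤ U →
      (1 - σ * c) * (lyapunov η r y - lyapunov η r x) + η / 2 * (clampAbove η y ^ r / n) +
        (σ * clampAbove η y ^ r * h' / (n + 1) - σ * clampAbove η x ^ r * h / n) ≤
      σ * clampAbove η y ^ r * (h' - m) / n +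
        (|e| / n + K * (U ^ (r + 1) + U / n) + |h'| / (n * (n + 1))) := by
  obtain ⟨K, hK0, hK⟩ := exists_abs_pow_sub_pow_mul_le hr (b := B + η + 1) (by positivity) hc
  refine ⟨K, hK0, ?_⟩
  intro σ v p h h' e m n x y U hσ hv hp hpB hn hdec hxy hhU hvU
  have hσ2 : σ * σ = 1 := by rw [← abs_mul_abs_self, hσ, one_mul]
  have hσ' := abs_le.1 hσ.le
  set ψ := clampAbove η y ^ r with hψ
  set ψ' := clampAbove η x ^ r with hψ'
  have hψ0 : 0 ≤ ψ := pow_nonneg (clampAbove_nonneg _ _) r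
  have hψ1 : ψ ≤ 1 := pow_le_one₀ (clampAbove_nonneg _ _) (clampAbove_le_one _ _)
  have h1 := hK (clampAbove η y) (clampAbove η x) (|h| / n) (v / n) U n (clampAbove_nonneg _ _)
    (clampAbove_le_one _ _) (clampAbove_nonneg _ _) (clampAbove_le_one _ _) (by positivity) hhU
    (by positivity) hvU hn (abs_clampAbove_sub_le hη hσ hv hp hpB hn hxy)
  rw [← hψ, ← hψ'] at h1
  have hE : (1 - σ * c) * (lyapunov η r y - lyapunov η r x) ≤ (1 - σ * c) * (ψ * (y - x)) := by
    refine mul_le_mul_of_nonneg_left (lyapunov_sub_le η r x y) ?_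
    nlinarith
  have hyx : y - x = (σ * (v - p) - y) / n := by rw [← hxy]; field_simp
  -- The factor `1 - σ c` creates the term `-c ψ v / n` that cancels the error: `v - p = σ (n (y -
  -- x) + y)` trades `c ψ v / n` for a multiple of `ψ (y - x)` and bounded corrections. Replacing
  -- `h` by `h'` next to `m` is summation by parts and produces a martingale difference.
  have hEeq : (1 - σ * c) * (ψ * (y - x)) = σ * ψ * (h' - m) / n -
      (σ * ψ * h' / (n + 1) - σ * ψ' * h / n) + (σ * ψ * e / n + σ * (ψ - ψ') * h / n -
      c * ψ * (v / n) - σ * ψ * h' / (n * (n + 1))) -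
      (ψ * y - c * ψ * (σ * y + p)) / n := by
    have h2 : (1 - σ * c) * (ψ * (y - x)) = ψ * (σ * (v - p) - y) / n -
        c * ψ * ((σ * σ) * (v - p) - σ * y) / n := by rw [hyx]; ring
    rw [h2, hσ2, hdec]
    have hv' : v = e + h - m + p := by linarith
    rw [hv']
    field_simp
    ring
  have habs (t : ℝ) : σ * t ≤ |t| := by
    calc σ * t ≤ |σ * t| := le_abs_self _
      _ = |t| := by rw [abs_mul, hσ, one_mul]
  have he : σ * ψ * e / n ≤ |e| / n := by
    gcongr
    rw [mul_assoc]
    refine (habs _).trans ?_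
    rw [abs_mul, abs_of_nonneg hψ0]
    exact mul_le_of_le_one_left (abs_nonneg _) hψ1
  have hh : σ * (ψ - ψ') * h / n ≤ |ψ' - ψ| * (|h| / n) := by
    rw [← mul_div_assoc]
    refine div_le_div_of_nonneg_right ?_ hn.le
    rw [mul_assoc, abs_sub_comm, ← abs_mul]
    exact habs _
  have hh' : -(σ * ψ * h' / (n * (n + 1))) ≤ |h'| / (n * (n + 1)) := by
    rw [← neg_div]
    gcongr
    rw [mul_assoc, ← mul_neg]
    refine (habs _).trans ?_
    rw [abs_neg, abs_mul, abs_of_nonneg hψ0]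
    exact mul_le_of_le_one_left (abs_nonneg _) hψ1
  -- Where `ψ ≠ 0` one has `y > η`, and the smallness of `c` costs at most `y / 4 + η / 4 ≤ y / 2`,
  -- leaving half of the pull towards zero.
  have hlast : η / 2 * (ψ / n) ≤ (ψ * y - c * ψ * (σ * y + p)) / n := by
    rw [← mul_div_assoc]
    gcongr
    rcases le_total y η with hy | hy
    · have : ψ = 0 := by rw [hψ, clampAbove_eq_zero hy, zero_pow hr]
      simp [this]
    · have h3 : c * (σ * y + p) ≤ y / 2 := by
        have h4 : c * (σ * y) ≤ c * y := by
          gcongr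
          nlinarith
        have h5 : c * y ≤ 1 / 4 * y := by
          gcongr
          linarith
        have h6 : c * p ≤ c * B := by gcongr
        linarith
      nlinarith
  linarith

lemma summable_div_of_summable_rpow {α : ℝ} (hα : 1 < α) {U : ℕ → ℝ} (hU0 : ∀ k, 0 ≤ U k)
    (hU : Summable fun k => U k ^ α) : Summable fun k : ℕ => U k / (k + 1 : ℝ) := by
  have hq := Real.HolderConjugate.conjExponent hα
  have h2 : Summable fun k : ℕ => ((1 : ℝ) / (k + 1 : ℝ)) ^ α.conjExponent := by
    have h3 := (summable_nat_add_iff 1).2 (Real.summable_one_div_nat_rpow.2 hq.symm.lt)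
    refine h3.congr fun k => ?_
    rw [Real.div_rpow zero_le_one (by positivity), Real.one_rpow]
    push_cast
    rfl
  refine Summable.of_nonneg_of_le (fun k => div_nonneg (hU0 k) (by positivity)) (fun k => ?_)
    ((hU.div_const α).add (h2.div_const α.conjExponent))
  have := Real.young_inequality_of_nonneg (hU0 k) (b := 1 / (k + 1 : ℝ)) (by positivity) hq
  rwa [mul_one_div] at this

lemma summable_pow_of_summable_rpow {α : ℝ} (hα : 0 < α) {U : ℕ → ℝ} (hU0 : ∀ k, 0 ≤ U k)
    (hU : Summable fun k => U k ^ α) {q : ℕ} (hq : α ≤ q) : Summable fun k => U k ^ q := by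
  refine Summable.of_norm_bounded_eventually_nat hU ?_
  filter_upwards [hU.tendsto_atTop_zero.eventually (gt_mem_nhds one_pos)] with k hk
  have h1 : U k ≤ 1 := by
    by_contra hgt
    exact absurd hk (not_lt.2 (Real.one_le_rpow (not_le.1 hgt).le hα.le))
  rw [Real.norm_of_nonneg (pow_nonneg (hU0 k) q), ← Real.rpow_natCast]
  exact Real.rpow_le_rpow_of_exponent_ge_of_imp (hU0 k) h1 hq
    (fun _ h => absurd h (hα.trans_le hq).ne')

end Lyapunov

/-! ### Pathwise analysis of the averages. -/

section Averages

variable {η B α σ : ℝ} {r : ℕ} {v p h e m a : ℕ → ℝ}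

/-- The noise term of the Lyapunov recursion for averages. -/
noncomputable def averageNoise (η : ℝ) (r : ℕ) (σ : ℝ) (h m a : ℕ → ℝ) (k : ℕ) : ℝ :=
  σ * clampAbove η (a (k + 1)) ^ r * (h (k + 1) - m k) / (k + 1 : ℝ)

/-- The Lyapunov recursion for averages, summed up. -/
lemma exists_lyapunov_sum_le (hr : r ≠ 0) (hη : 0 < η) (hα : 1 < α) (hαr : α ≤ r + 1)
    (hσ : |σ| = 1) (hv : ∀ k, 0 ≤ v k) (hp : ∀ k, 0 ≤ p k) (hpB : ∀ k, p k ≤ B)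
    (hdec : ∀ k, v k - p k = e k + h k - m k)
    (ha : ∀ k : ℕ, (k + 1 : ℝ) * (a (k + 1) - a k) = σ * (v k - p k) - a (k + 1))
    (hU : Summable fun k : ℕ => ((|h k| + v k) / (k + 1 : ℝ)) ^ α)
    (he : Summable fun k : ℕ => |e k| / (k + 1 : ℝ)) :
    ∃ (c : ℝ) (T R : ℕ → ℝ), 0 < c ∧ Summable R ∧ (∀ k, 0 ≤ R k) ∧ Tendsto T atTop (𝓝 0) ∧
      ∀ k : ℕ, c * (lyapunov η r (a (k + 1)) - lyapunov η r (a k)) +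
        η / 2 * (clampAbove η (a (k + 1)) ^ r / (k + 1 : ℝ)) + (T (k + 1) - T k) ≤
        averageNoise η r σ h m a k + R k := by
  have hB : 0 ≤ B := (hp 0).trans (hpB 0)
  set c := min (1 / 4) (η / (4 * (B + 1))) with hc
  have hc0 : 0 < c := lt_min (by norm_num) (by positivity)
  have hc4 : c ≤ 1 / 4 := min_le_left _ _
  have hcB : c * B ≤ η / 4 := by
    calc c * B ≤ η / (4 * (B + 1)) * (B + 1) := by
          gcongr
          · exact min_le_right _ _
          · linarith
      _ = η / 4 := by field_simp
  obtain ⟨K, hK0, hK⟩ := exists_lyapunov_step hr hη hB hc0 hc4 hcB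
  set U : ℕ → ℝ := fun k => (|h k| + v k) / (k + 1 : ℝ) with hUdef
  have hU0 (k : ℕ) : 0 ≤ U k := div_nonneg (add_nonneg (abs_nonneg _) (hv k)) (by positivity)
  have hUtend : Tendsto U atTop (𝓝 0) := by
    have h1 := (summable_pow_of_summable_rpow (by linarith) hU0 hU
      (q := r + 1) (by exact_mod_cast hαr)).tendsto_atTop_zero
    have h2 := h1.rpow_const (p := ((r + 1 : ℕ) : ℝ)⁻¹) (Or.inr (by positivity))
    rw [Real.zero_rpow (by positivity)] at h2
    exact h2.congr fun k => Real.pow_rpow_inv_natCast (hU0 k) (Nat.succ_ne_zero r)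
  have hU1 := summable_div_of_summable_rpow hα hU0 hU
  have hU2 := summable_div_of_summable_rpow hα (fun k => hU0 (k + 1))
    ((summable_nat_add_iff (f := fun k => U k ^ α) 1).2 hU)
  have hUp := summable_pow_of_summable_rpow (by linarith) hU0 hU (q := r + 1)
    (by exact_mod_cast hαr)
  have hhU (k : ℕ) : |h k| / (k + 1 : ℝ) ≤ U k := by
    simp only [hUdef]
    gcongr
    linarith [hv k]
  -- `T` is the boundary term of the summation by parts and vanishes because `U → 0`. In `R`, the
  -- power `U^(r+1)` is summable as `α ≤ r + 1`, and the terms divided once more by `k` are summable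
  -- by Young's inequality as `α > 1`.
  refine ⟨1 - σ * c, fun k => σ * clampAbove η (a k) ^ r * h k / (k + 1 : ℝ),
    fun k => |e k| / (k + 1 : ℝ) + K * (U k ^ (r + 1) + U k / (k + 1 : ℝ)) +
      |h (k + 1)| / ((k + 1 : ℝ) * (k + 1 + 1)), ?_, ?_, ?_, ?_, ?_⟩
  · have := (abs_le.1 hσ.le).2
    nlinarith
  · refine (he.add ((hUp.add hU1).mul_left K)).add (Summable.of_nonneg_of_le
      (fun k => by positivity) (fun k => ?_) hU2)
    have := hhU (k + 1)
    push_cast at this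
    rw [mul_comm, ← div_div]
    gcongr
  · intro k
    have := hU0 k
    positivity
  · refine squeeze_zero_norm (fun k => ?_) hUtend
    refine le_trans ?_ (hhU k)
    rw [Real.norm_eq_abs, abs_div, abs_mul, abs_mul, hσ, one_mul,
      abs_of_nonneg (pow_nonneg (clampAbove_nonneg η (a k)) r),
      abs_of_pos (show (0 : ℝ) < k + 1 by positivity)]
    gcongr
    exact mul_le_of_le_one_left (abs_nonneg _)
      (pow_le_one₀ (clampAbove_nonneg _ _) (clampAbove_le_one _ _))
  · intro k
    have := hK σ (v k) (p k) (h k) (h (k + 1)) (e k) (m k) (k + 1) (a k) (a (k + 1)) (U k) hσ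
      (hv k) (hp k) (hpB k) (by positivity) (hdec k) (ha k) (hhU k) (by
        simp only [hUdef]
        gcongr
        linarith [abs_nonneg (h k)])
    simp only [averageNoise]
    push_cast
    exact this

/-- In the summed recursion the Lyapunov function and the dissipation are nonnegative, while `T` and
the sums of `R` stay bounded; the noise therefore cannot drift to `-∞`. -/
lemma sum_averageNoise_bddBelow (hr : r ≠ 0) (hη : 0 < η) (hα : 1 < α) (hαr : α ≤ r + 1)
    (hσ : |σ| = 1) (hv : ∀ k, 0 ≤ v k) (hp : ∀ k, 0 ≤ p k) (hpB : ∀ k, p k ≤ B)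
    (hdec : ∀ k, v k - p k = e k + h k - m k)
    (ha : ∀ k : ℕ, (k + 1 : ℝ) * (a (k + 1) - a k) = σ * (v k - p k) - a (k + 1))
    (hU : Summable fun k : ℕ => ((|h k| + v k) / (k + 1 : ℝ)) ^ α)
    (he : Summable fun k : ℕ => |e k| / (k + 1 : ℝ)) :
    ∃ C : ℝ, ∀ n, C ≤ ∑ k ∈ Finset.range n, averageNoise η r σ h m a k := by
  obtain ⟨c, T, R, hc, hR, hR0, hT, hstep⟩ :=
    exists_lyapunov_sum_le hr hη hα hαr hσ hv hp hpB hdec ha hU he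
  obtain ⟨L, hL⟩ := hT.bddBelow_range
  refine ⟨-(c * lyapunov η r (a 0)) + L - T 0 - ∑' k, R k, fun n => ?_⟩
  have h1 := Finset.sum_le_sum fun k (_ : k ∈ Finset.range n) => hstep k
  rw [Finset.sum_add_distrib, Finset.sum_add_distrib, ← Finset.mul_sum, Finset.sum_range_sub
    (fun k => lyapunov η r (a k)), Finset.sum_range_sub, Finset.sum_add_distrib] at h1
  have h2 : 0 ≤ ∑ k ∈ Finset.range n, η / 2 * (clampAbove η (a (k + 1)) ^ r / (k + 1 : ℝ)) :=
    Finset.sum_nonneg fun k _ => by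
      have := clampAbove_nonneg η (a (k + 1))
      positivity
  have h3 := mul_nonneg hc.le (lyapunov_nonneg hη.le hr (a n))
  have h4 := hL ⟨n, rfl⟩
  have h5 := hR.sum_le_tsum (Finset.range n) fun k _ => hR0 k
  linarith

/-- A deterministic Robbins–Siegmund argument: once the noise converges, the gap `Z` in the summed
inequality is monotone and bounded, so the dissipation is summable and the Lyapunov function
converges. -/
lemma eventually_le_of_tendsto_sum_averageNoise (hr : r ≠ 0) (hη : 0 < η) (hα : 1 < α)
    (hαr : α ≤ r + 1)
    (hσ : |σ| = 1) (hv : ∀ k, 0 ≤ v k) (hp : ∀ k, 0 ≤ p k) (hpB : ∀ k, p k ≤ B)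
    (hdec : ∀ k, v k - p k = e k + h k - m k)
    (ha : ∀ k : ℕ, (k + 1 : ℝ) * (a (k + 1) - a k) = σ * (v k - p k) - a (k + 1))
    (hU : Summable fun k : ℕ => ((|h k| + v k) / (k + 1 : ℝ)) ^ α)
    (he : Summable fun k : ℕ => |e k| / (k + 1 : ℝ))
    (hN : ∃ l, Tendsto (fun n => ∑ k ∈ Finset.range n, averageNoise η r σ h m a k) atTop (𝓝 l)) :
    ∀ᶠ n in atTop, a n < 2 * η := by
  obtain ⟨c, T, R, hc, hR, hR0, hT, hstep⟩ :=
    exists_lyapunov_sum_le hr hη hα hαr hσ hv hp hpB hdec ha hU he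
  obtain ⟨l, hl⟩ := hN
  set ψ : ℕ → ℝ := fun k => clampAbove η (a (k + 1)) ^ r / (k + 1 : ℝ) with hψ
  have hψ0 (k : ℕ) : 0 ≤ ψ k := by
    have := clampAbove_nonneg η (a (k + 1))
    simp only [hψ]; positivity
  set φ : ℕ → ℝ := fun n => lyapunov η r (a n) with hφ
  have hφ0 (n : ℕ) : 0 ≤ φ n := lyapunov_nonneg hη.le hr (a n)
  set Q : ℕ → ℝ := fun n => ∑ k ∈ Finset.range n, (averageNoise η r σ h m a k + R k) with hQ
  have hQlim : Tendsto Q atTop (𝓝 (l + ∑' k, R k)) := by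
    simp only [hQ, Finset.sum_add_distrib]
    exact hl.add hR.hasSum.tendsto_sum_nat
  set S : ℕ → ℝ := fun n => ∑ k ∈ Finset.range n, ψ k with hS
  have hS0 (n : ℕ) : 0 ≤ S n := Finset.sum_nonneg fun k _ => hψ0 k
  set Z : ℕ → ℝ := fun n => Q n - (c * φ n + η / 2 * S n + T n) with hZ
  have hZmono : Monotone Z := monotone_nat_of_le_succ fun n => by
    have := hstep n
    simp only [hZ, hQ, hS, hφ, hψ, Finset.sum_range_succ] at this ⊢
    nlinarith
  have hZbdd : BddAbove (Set.range Z) := by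
    obtain ⟨q, hq⟩ := (hQlim.sub hT).bddAbove_range
    refine ⟨q, ?_⟩
    rintro _ ⟨n, rfl⟩
    have h1 := hq ⟨n, rfl⟩
    have h2 := mul_nonneg hc.le (hφ0 n)
    have h3 := mul_nonneg hη.le (hS0 n)
    simp only [hZ] at h1 ⊢
    linarith
  have hW := (hQlim.sub (tendsto_atTop_ciSup hZmono hZbdd)).sub hT
  have hW' : Tendsto (fun n => c * φ n + η / 2 * S n) atTop
      (𝓝 (l + ∑' k, R k - (⨆ n, Z n) - 0)) := hW.congr fun n => by simp only [hZ]; ring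
  have hSsum : Summable ψ := by
    obtain ⟨q, hq⟩ := hW'.bddAbove_range
    refine summable_of_sum_range_le (c := q / (η / 2)) hψ0 fun n => ?_
    rw [le_div_iff₀ (by positivity)]
    have h1 := hq ⟨n, rfl⟩
    have h2 := mul_nonneg hc.le (hφ0 n)
    simp only [hS] at h1
    linarith
  have hφlim : ∃ d, Tendsto φ atTop (𝓝 d) := by
    have h1 := ((hW'.sub (hSsum.hasSum.tendsto_sum_nat.const_mul (η / 2))).const_mul c⁻¹)
    refine ⟨_, h1.congr fun n => ?_⟩
    simp only [hS, add_sub_cancel_right]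
    exact inv_mul_cancel_left₀ hc.ne' _
  obtain ⟨d, hd⟩ := hφlim
  -- A positive limit would keep the averages above some `δ > η`, and the dissipation would dominate
  -- a multiple of the harmonic series. The slope is at most `1`, so `δ = η + d / 2` has Lyapunov
  -- value at most `d / 2`.
  have hd0 : d ≤ 0 := by
    by_contra hpos
    push Not at hpos
    set δ := η + d / 2 with hδ
    have hδφ : lyapunov η r δ < d := by
      have h1 := lyapunov_sub_le η r η δ
      rw [lyapunov_eq_zero hη.le hr le_rfl] at h1
      have h2 : clampAbove η δ ^ r ≤ 1 :=
        pow_le_one₀ (clampAbove_nonneg _ _) (clampAbove_le_one _ _)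
      nlinarith
    have hev := hd.eventually (lt_mem_nhds hδφ)
    have hc1 : 0 < clampAbove η δ ^ r := pow_pos (clampAbove_pos (by linarith)) r
    have hdiv : Summable fun k : ℕ => clampAbove η δ ^ r * (1 / (k + 1 : ℝ)) := by
      refine Summable.of_norm_bounded_eventually_nat hSsum ?_
      filter_upwards [(tendsto_add_atTop_nat 1).eventually hev] with k hk
      have hk' : δ < a (k + 1) := (lyapunov_mono η r).reflect_lt hk
      rw [Real.norm_of_nonneg (by positivity), mul_one_div]
      simp only [hψ]
      gcongr
      · exact clampAbove_nonneg _ _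
      · exact clampAbove_mono η hk'.le
    have h3 := (summable_mul_left_iff hc1.ne').1 hdiv
    have h4 : Summable fun k : ℕ => 1 / ((k + 1 : ℕ) : ℝ) := by exact_mod_cast h3
    exact Real.not_summable_one_div_natCast ((summable_nat_add_iff 1).1 h4)
  have hd_lt : d < lyapunov η r (2 * η) := hd0.trans_lt (lyapunov_pos hη.le hr (by linarith))
  filter_upwards [hd.eventually (gt_mem_nhds hd_lt)] with n hn
  exact (lyapunov_mono η r).reflect_lt hn

end Averages

/-! ### Averages along the adaptive chain. -/

section StochasticAverages

variable {X Θ Ω : Type*} [MeasurableSpace X] [MeasurableSpace Θ] {mΩ : MeasurableSpace Ω}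
  {P : Θ → Kernel X X} [∀ t, IsMarkovKernel (P t)] {μ : Measure Ω} [IsProbabilityMeasure μ]
  {ℱ : Filtration ℕ mΩ} {x : ℕ → Ω → X} {θ : ℕ → Ω → Θ}

lemma ofReal_abs_rpow_eq (z : ℝ) {α : ℝ} (hα : 0 ≤ α) :
    ENNReal.ofReal (|z| ^ α) = ‖z‖ₑ ^ α := by
  rw [Real.enorm_eq_ofReal_abs, ENNReal.ofReal_rpow_of_nonneg (abs_nonneg z) hα]

lemma enorm_one_div_natCast_succ_rpow (k : ℕ) (α : ℝ) :
    ‖(1 : ℝ) / (k + 1 : ℝ)‖ₑ ^ α = ((k + 1 : ℕ) : ℝ≥0∞) ^ (-α) := by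
  rw [ENNReal.rpow_neg, ← ENNReal.inv_rpow, one_div, enorm_inv (by positivity)]
  congr 2
  rw [← Nat.cast_succ, Real.enorm_natCast]

/-- Summable conditional moments along the chain give summable moments of the next states. -/
lemma ae_summable_rpow_of_transition (hP : Measurable fun p : Θ × X => P p.1 p.2)
    (hx : ∀ n, Measurable[ℱ n] (x n)) (hθ : ∀ n, Measurable[ℱ n] (θ n))
    (hMarkov : ∀ (n : ℕ) (f : X → ℝ), Measurable f → (∃ M : ℝ, ∀ y, |f y| ≤ M) →
      μ[fun ω => f (x (n + 1) ω) | ℱ n] =ᵐ[μ] fun ω => ∫ y, f y ∂(P (θ n ω) (x n ω)))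
    {W : Θ × X → ℝ} (hW : Measurable W) {α : ℝ} (hα : 0 ≤ α)
    (hsum : ∀ᵐ ω ∂μ, ∑' k : ℕ, ((k + 1 : ℕ) : ℝ≥0∞) ^ (-α) *
      ∫⁻ y, ‖W (θ k ω, y)‖ₑ ^ α ∂(P (θ k ω) (x k ω)) < ∞) :
    ∀ᵐ ω ∂μ, Summable fun k : ℕ => (|W (θ k ω, x (k + 1) ω)| / (k + 1 : ℝ)) ^ α := by
  have hx0 (n : ℕ) : Measurable (x n) := (hx n).mono (ℱ.le n) le_rfl
  have hθ0 (n : ℕ) : Measurable (θ n) := (hθ n).mono (ℱ.le n) le_rfl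
  have key := ae_tsum_lt_top_of_compensator (μ := μ) (𝒢 := ℱ)
    (y := fun k ω => ((k + 1 : ℕ) : ℝ≥0∞) ^ (-α) * ‖W (θ k ω, x (k + 1) ω)‖ₑ ^ α)
    (J := fun k ω => ((k + 1 : ℕ) : ℝ≥0∞) ^ (-α) *
      ∫⁻ y, ‖W (θ k ω, y)‖ₑ ^ α ∂(P (θ k ω) (x k ω)))
    (fun k => ((hW.comp ((hθ0 k).prodMk (hx0 (k + 1)))).enorm.pow_const α).const_mul _)
    (fun k => ((measurable_lintegral_family hP (hW.enorm.pow_const α)).comp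
      ((hθ k).prodMk (hx k))).const_mul _)
    (fun k A hA => by
      have h1 := setLIntegral_transition hP (ℱ.le k) (hx k) (hθ k) (hx0 (k + 1)) (hMarkov k) hA
        (hW.enorm.pow_const α)
      have hm : Measurable fun ω => ∫⁻ y, ‖W (θ k ω, y)‖ₑ ^ α ∂(P (θ k ω) (x k ω)) :=
        (measurable_lintegral_family hP (hW.enorm.pow_const α)).comp ((hθ0 k).prodMk (hx0 k))
      have hm' : Measurable fun ω => ‖W (θ k ω, x (k + 1) ω)‖ₑ ^ α :=
        (hW.comp ((hθ0 k).prodMk (hx0 (k + 1)))).enorm.pow_const α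
      rw [lintegral_const_mul _ hm', lintegral_const_mul _ hm]
      exact (congrArg _ h1).le)
    hsum
  filter_upwards [key] with ω hω
  refine (ENNReal.summable_toReal hω.ne).congr fun k => ?_
  rw [← enorm_one_div_natCast_succ_rpow, ← ENNReal.mul_rpow_of_nonneg _ _ hα, ← enorm_mul,
    ← ofReal_abs_rpow_eq _ hα, ENNReal.toReal_ofReal (by positivity), abs_mul, abs_div, abs_one,
    abs_of_pos (show (0 : ℝ) < k + 1 by positivity), one_div, ← div_eq_inv_mul]

/-- Averages of `g (θ k, x k) - p (θ k)` tend to zero, where `H` solves the Poisson equation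
`H - P H = g - p` along the chain. -/
theorem ae_tendsto_average_of_poisson (hP : Measurable fun p : Θ × X => P p.1 p.2)
    (hx : ∀ n, Measurable[ℱ n] (x n)) (hθ : ∀ n, Measurable[ℱ n] (θ n))
    (hMarkov : ∀ (n : ℕ) (f : X → ℝ), Measurable f → (∃ M : ℝ, ∀ y, |f y| ≤ M) →
      μ[fun ω => f (x (n + 1) ω) | ℱ n] =ᵐ[μ] fun ω => ∫ y, f y ∂(P (θ n ω) (x n ω)))
    {g H : Θ × X → ℝ} {p : Θ → ℝ} {W : X → ℝ} (hg : Measurable g) (hH : Measurable H)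
    (hp : Measurable p) (hW : Measurable W) (hg0 : ∀ q, 0 ≤ g q) (hgW : ∀ q, g q ≤ W q.2)
    (hp0 : ∀ᵐ ω ∂μ, ∀ k, 0 ≤ p (θ k ω)) (hpB : ∀ᵐ ω ∂μ, ∃ B, ∀ k, p (θ k ω) ≤ B)
    (hpoisson : ∀ᵐ ω ∂μ, ∀ k, g (θ k ω, x k ω) - p (θ k ω) =
      H (θ k ω, x k ω) - ∫ y, H (θ k ω, y) ∂(P (θ k ω) (x k ω)))
    {α : ℝ} (hα : 1 < α)
    (hsum : ∀ᵐ ω ∂μ, ∑' k : ℕ, ((k + 1 : ℕ) : ℝ≥0∞) ^ (-α) *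
      ∫⁻ y, ‖|H (θ k ω, y)| + W y‖ₑ ^ α ∂(P (θ k ω) (x k ω)) < ∞)
    (hvar : ∀ᵐ ω ∂μ, Summable fun k : ℕ =>
      |H (θ (k + 1) ω, x (k + 1) ω) - H (θ k ω, x (k + 1) ω)| / (k + 1 : ℝ)) :
    ∀ᵐ ω ∂μ, Tendsto (fun n : ℕ => (n : ℝ)⁻¹ *
      ∑ k ∈ Finset.range n, (g (θ k ω, x k ω) - p (θ k ω))) atTop (𝓝 0) := by
  have hα0 : 0 ≤ α := by linarith
  have hW0 (y : X) (t : Θ) : 0 ≤ W y := (hg0 (t, y)).trans (hgW (t, y))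
  have hx0 (n : ℕ) : Measurable (x n) := (hx n).mono (ℱ.le n) le_rfl
  obtain ⟨r, hr⟩ := exists_nat_ge α
  have hr0 : r ≠ 0 := by
    rintro rfl
    norm_num at hr
    linarith
  have hHW : Measurable fun q : Θ × X => |H q| + W q.2 := hH.abs.add (hW.comp measurable_snd)
  have hUsum := ae_summable_rpow_of_transition hP hx hθ hMarkov hHW hα0 hsum
  let v (k : ℕ) (ω : Ω) : ℝ := g (θ (k + 1) ω, x (k + 1) ω)
  let q (k : ℕ) (ω : Ω) : ℝ := p (θ (k + 1) ω)
  let h (k : ℕ) (ω : Ω) : ℝ := H (θ k ω, x (k + 1) ω)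
  let m (k : ℕ) (ω : Ω) : ℝ := ∫ y, H (θ (k + 1) ω, y) ∂(P (θ (k + 1) ω) (x (k + 1) ω))
  let e (k : ℕ) (ω : Ω) : ℝ := H (θ (k + 1) ω, x (k + 1) ω) - H (θ k ω, x (k + 1) ω)
  -- Dividing by `k + 1` instead of `k` avoids a zero denominator and gives the implicit recursion
  -- with `a (k + 1)` on the right.
  let a (σ : ℝ) (k : ℕ) (ω : Ω) : ℝ :=
    σ * (∑ j ∈ Finset.range k, (v j ω - q j ω)) / (k + 1 : ℝ)
  have ha (σ : ℝ) (ω : Ω) (k : ℕ) : (k + 1 : ℝ) * (a σ (k + 1) ω - a σ k ω) =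
      σ * (v k ω - q k ω) - a σ (k + 1) ω := by
    simp only [a, Finset.sum_range_succ]
    push_cast
    field_simp
    ring
  -- The `k`-th noise term concerns the transition from time `k + 1` to `k + 2`, and its weight
  -- depends on the chain up to time `k + 1`; hence the shift.
  let 𝒢 : Filtration ℕ mΩ := ⟨fun k => ℱ (k + 1), fun i j hij => ℱ.mono (by omega),
    fun k => ℱ.le _⟩
  have hvm (j : ℕ) : Measurable[ℱ (j + 1)] fun ω => v j ω - q j ω :=
    (hg.comp ((hθ (j + 1)).prodMk (hx (j + 1)))).sub (hp.comp (hθ (j + 1)))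
  have ham (σ : ℝ) (k : ℕ) : Measurable[ℱ (k + 1)] (a σ (k + 1)) :=
    ((Finset.measurable_fun_sum _ fun j hj => (hvm j).mono
      (ℱ.mono (Finset.mem_range_succ_iff.1 hj |> Nat.succ_le_succ)) le_rfl).const_mul σ).div_const _
  have hnoise (σ η : ℝ) (hσ : |σ| = 1) (hη : 0 < η) : ∀ᵐ ω ∂μ, ∀ᶠ n in atTop,
      a σ n ω < 2 * η := by
    let z (k : ℕ) (ω : Ω) : ℝ := σ * clampAbove η (a σ (k + 1) ω) ^ r / (k + 1 : ℝ)
    have hzm (k : ℕ) : Measurable[ℱ (k + 1)] (z k) :=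
      ((((continuous_clampAbove η).measurable.comp (ham σ k)).pow_const r).const_mul σ).div_const _
    have hz (k : ℕ) (ω : Ω) : ‖z k ω‖ₑ ≤ ‖(1 : ℝ) / (k + 1 : ℝ)‖ₑ := by
      rw [enorm_le_iff_norm_le, Real.norm_eq_abs, Real.norm_eq_abs]
      simp only [z]
      rw [abs_div, abs_div, abs_mul, hσ, one_mul, abs_one,
        abs_of_nonneg (pow_nonneg (clampAbove_nonneg _ _) r)]
      gcongr
      exact pow_le_one₀ (clampAbove_nonneg _ _) (clampAbove_le_one _ _)
    let J (k : ℕ) (ω : Ω) : ℝ≥0∞ := ((k + 1 : ℕ) : ℝ≥0∞) ^ (-α) * (2 ^ α *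
      ∫⁻ y, ‖H (θ (k + 1) ω, y)‖ₑ ^ α ∂(P (θ (k + 1) ω) (x (k + 1) ω)))
    have hξeq (k : ℕ) (ω : Ω) :
        averageNoise η r σ (fun k => h k ω) (fun k => m k ω) (fun k => a σ k ω) k =
        z k ω * (H (θ (k + 1) ω, x (k + 1 + 1) ω) -
          ∫ y, H (θ (k + 1) ω, y) ∂(P (θ (k + 1) ω) (x (k + 1) ω))) := by
      simp only [averageNoise, z, h, m]
      ring
    have hHt (t : Θ) : Measurable fun y => H (t, y) := hH.comp measurable_prodMk_left
    have hconv := ae_exists_tendsto_of_bddBelow (μ := μ) (𝒢 := 𝒢) (α := α) (J := J)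
      (ξ := fun k ω =>
        averageNoise η r σ (fun k => h k ω) (fun k => m k ω) (fun k => a σ k ω) k)
      hα.le
      (fun k => by
        simp only [hξeq]
        have h1 : Measurable[ℱ (k + 2)] (z k) := (hzm k).mono (ℱ.mono (by omega)) le_rfl
        have h2 : Measurable[ℱ (k + 2)] (θ (k + 1)) := (hθ (k + 1)).mono (ℱ.mono (by omega)) le_rfl
        have h3 : Measurable[ℱ (k + 2)] (x (k + 1)) := (hx (k + 1)).mono (ℱ.mono (by omega)) le_rfl
        exact h1.mul ((hH.comp (h2.prodMk (hx (k + 2)))).sub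
          ((measurable_integral_family hP hH).comp (h2.prodMk h3))))
      (fun k => (((measurable_lintegral_family hP (hH.enorm.pow_const α)).comp
        ((hθ (k + 1)).prodMk (hx (k + 1)))).const_mul _).const_mul _)
      (fun k A hA => by
        simp only [hξeq, ofReal_abs_rpow_eq _ hα0]
        rw [setLIntegral_mul_sub_rpow hP (ℱ.le (k + 1)) (hx (k + 1)) (hθ (k + 1)) (hx0 (k + 1 + 1))
          (hMarkov (k + 1)) hA hH (hzm k) α]
        refine lintegral_mono fun ω => ?_
        refine (lintegral_mul_sub_integral_rpow_le (hHt _) hα.le _).trans ?_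
        simp only [J]
        rw [← enorm_one_div_natCast_succ_rpow]
        gcongr
        exact hz k ω)
      (fun k A hA B hB => by
        simp only [hξeq]
        refine setIntegral_mul_sub_eq_zero hP (ℱ.le (k + 1)) (hx (k + 1)) (hθ (k + 1))
          (hx0 (k + 1 + 1)) (hMarkov (k + 1)) hA hH (hzm k) fun ω hω => ?_
        refine integrable_of_lintegral_rpow_lt_top (hHt _) hα.le ?_
        have h1 := (hB ω hω).trans_lt (ENNReal.natCast_lt_top B)
        simp only [J] at h1
        by_contra htop
        rw [not_lt_top_iff] at htop
        rw [htop, ENNReal.mul_top (by simp), ENNReal.mul_top] at h1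
        · exact lt_irrefl _ h1
        · simp [ENNReal.rpow_eq_zero_iff])
      (by
        filter_upwards [hsum] with ω hω
        have h1 : ∑' k : ℕ, ((k + 1 + 1 : ℕ) : ℝ≥0∞) ^ (-α) *
            ∫⁻ y, ‖|H (θ (k + 1) ω, y)| + W y‖ₑ ^ α ∂(P (θ (k + 1) ω) (x (k + 1) ω)) < ∞ :=
          (ENNReal.tsum_comp_le_tsum_of_injective (add_left_injective 1) _).trans_lt hω
        refine lt_of_le_of_lt (ENNReal.tsum_le_tsum (g := fun k : ℕ => (2 ^ α * 2 ^ α) *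
          (((k + 1 + 1 : ℕ) : ℝ≥0∞) ^ (-α) *
            ∫⁻ y, ‖|H (θ (k + 1) ω, y)| + W y‖ₑ ^ α ∂(P (θ (k + 1) ω) (x (k + 1) ω))))
          fun k => ?_) ?_
        · have h2 : ((k + 1 : ℕ) : ℝ≥0∞) ^ (-α) ≤ 2 ^ α * ((k + 1 + 1 : ℕ) : ℝ≥0∞) ^ (-α) := by
            rw [ENNReal.rpow_neg, ENNReal.rpow_neg, ← ENNReal.div_eq_inv_mul.trans (mul_comm _ _),
              ENNReal.le_div_iff_mul_le (Or.inl (by simp [ENNReal.rpow_eq_zero_iff]))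
                (Or.inl (by simp [ENNReal.rpow_eq_top_iff])),
              ← ENNReal.div_eq_inv_mul, ← ENNReal.div_rpow_of_nonneg _ _ hα0]
            refine ENNReal.rpow_le_rpow ?_ hα0
            rw [ENNReal.div_le_iff (by simp) (by simp)]
            exact_mod_cast (by omega : k + 1 + 1 ≤ 2 * (k + 1))
          simp only [J]
          calc _ ≤ (2 ^ α * ((k + 1 + 1 : ℕ) : ℝ≥0∞) ^ (-α)) * (2 ^ α *
              ∫⁻ y, ‖|H (θ (k + 1) ω, y)| + W y‖ₑ ^ α ∂(P (θ (k + 1) ω) (x (k + 1) ω))) := by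
                gcongr with y
                rw [enorm_le_iff_norm_le, Real.norm_eq_abs, Real.norm_eq_abs]
                exact (le_add_of_nonneg_right (hW0 y (θ 0 ω))).trans (le_abs_self _)
            _ = _ := by ring
        · rw [ENNReal.tsum_mul_left]
          exact ENNReal.mul_lt_top (by
            rw [← ENNReal.mul_rpow_of_nonneg _ _ hα0]
            exact ENNReal.rpow_lt_top_of_nonneg hα0 (by finiteness)) h1)
    have hfacts : ∀ᵐ ω ∂μ, (∀ k, v k ω - q k ω = e k ω + h k ω - m k ω) ∧ (∀ k, 0 ≤ q k ω) ∧
        (∃ B, ∀ k, q k ω ≤ B) ∧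
        Summable (fun k : ℕ => ((|h k ω| + v k ω) / (k + 1 : ℝ)) ^ α) := by
      filter_upwards [hpoisson, hp0, hpB, hUsum] with ω h1 h2 h3 h4
      refine ⟨fun k => ?_, fun k => h2 (k + 1), ⟨h3.choose, fun k => h3.choose_spec (k + 1)⟩, ?_⟩
      · have := h1 (k + 1)
        simp only [v, q, e, h, m]
        linarith
      · refine Summable.of_nonneg_of_le (fun k => ?_) (fun k => ?_) h4
        · have := hg0 (θ (k + 1) ω, x (k + 1) ω)
          simp only [v]
          positivity
        · have h5 := hg0 (θ (k + 1) ω, x (k + 1) ω)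
          simp only [v, h]
          gcongr
          exact (add_le_add le_rfl (hgW _)).trans (le_abs_self _)
    have hαr : α ≤ (r : ℝ) + 1 := by linarith
    have hbdd : ∀ᵐ ω ∂μ, ∃ c : ℝ, ∀ n, c ≤ ∑ k ∈ Finset.range n,
        averageNoise η r σ (fun k => h k ω) (fun k => m k ω) (fun k => a σ k ω) k := by
      filter_upwards [hfacts, hvar] with ω ⟨h1, h2, ⟨B, h3⟩, h4⟩ h5
      exact sum_averageNoise_bddBelow hr0 hη hα hαr hσ (fun k => hg0 _) h2 h3 h1 (ha σ ω) h4 h5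
    filter_upwards [hfacts, hvar, hconv hbdd] with ω ⟨h1, h2, ⟨B, h3⟩, h4⟩ h5 h6
    exact eventually_le_of_tendsto_sum_averageNoise hr0 hη hα hαr hσ (fun k => hg0 _) h2 h3 h1
      (ha σ ω) h4 h5 h6
  -- Countably many levels `η = 1 / (j + 1)` and both signs give a single almost sure event on which
  -- the averages vanish from above and below.
  have hall : ∀ᵐ ω ∂μ, ∀ j : ℕ, ∀ᶠ n in atTop,
      a 1 n ω < 2 * (1 / (j + 1 : ℝ)) ∧ a (-1) n ω < 2 * (1 / (j + 1 : ℝ)) :=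
    ae_all_iff.2 fun j => by
      filter_upwards [hnoise 1 (1 / (j + 1 : ℝ)) (by simp) (by positivity),
        hnoise (-1) (1 / (j + 1 : ℝ)) (by simp) (by positivity)] with ω h1 h2
      exact h1.and h2
  filter_upwards [hall] with ω hω
  have hlim : Tendsto (fun n => a 1 n ω) atTop (𝓝 0) := by
    rw [Metric.tendsto_atTop']
    intro ε hε
    obtain ⟨j, hj⟩ := exists_nat_one_div_lt (show 0 < ε / 2 by positivity)
    obtain ⟨N, hN⟩ := eventually_atTop.1 (hω j)
    refine ⟨N, fun n hn => ?_⟩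
    obtain ⟨h1, h2⟩ := hN n hn.le
    have h3 : a (-1) n ω = -a 1 n ω := by simp only [a]; ring
    rw [h3] at h2
    rw [Real.dist_eq, sub_zero]
    exact abs_lt.2 ⟨by linarith, by linarith⟩
  rw [← tendsto_add_atTop_iff_nat 1]
  -- The averages `a` start with the state at time `1`; the initial term is restored separately.
  have h0 : Tendsto (fun n : ℕ => (g (θ 0 ω, x 0 ω) - p (θ 0 ω)) * (1 / (n + 1 : ℝ))) atTop
      (𝓝 ((g (θ 0 ω, x 0 ω) - p (θ 0 ω)) * 0)) :=
    tendsto_one_div_add_atTop_nhds_zero_nat.const_mul _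
  have h1 := hlim.add h0
  rw [mul_zero, add_zero] at h1
  refine h1.congr fun n => ?_
  rw [Finset.sum_range_succ']
  simp only [a, v, q]
  push_cast
  field_simp

end StochasticAverages

/-! ### From the assumptions on `L`, `V` and `F` to the averages. -/

section Main

variable {X : Type*} [MeasurableSpace X] {V : X → ℝ} {κ η : Kernel X X}

lemma one_le_ergodicityL : 1 ≤ ergodicityL V κ := by
  refine le_iInf fun C => le_iInf fun ρ => le_iInf fun h => ?_
  rw [← ENNReal.ofReal_one]
  refine ENNReal.ofReal_le_ofReal (le_max_of_le_right ?_)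
  exact (one_le_inv₀ (by linarith [h.2.1.2])).2 (by linarith [h.2.1.1])

lemma one_le_toReal_ergodicityL (hL : ergodicityL V κ ≠ ∞) : 1 ≤ (ergodicityL V κ).toReal :=
  (ENNReal.toReal_mono hL one_le_ergodicityL).trans' (by simp)

/-- As `V ≥ 1`, the conditional moment is at least `1`, so an infinite `L` would make a term of the
series infinite. -/
lemma ergodicityL_ne_top_of_tsum {κ : ℕ → Kernel X X} [∀ k, IsMarkovKernel (κ k)] {x : ℕ → X}
    {α : ℝ} (hα : 0 < α) (hV : ∀ y, 1 ≤ V y)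
    (h : (∑' k : ℕ, ((k + 1 : ℕ) : ℝ≥0∞) ^ (-α) * ergodicityL V (κ k) ^ (2 * α) *
      ∫⁻ y, ENNReal.ofReal (V y ^ α) ∂(κ k (x k))) < ∞) (k : ℕ) : ergodicityL V (κ k) ≠ ∞ := by
  intro htop
  have h1 := ENNReal.ne_top_of_tsum_ne_top h.ne k
  rw [htop, ENNReal.top_rpow_of_pos (by positivity), ENNReal.mul_top (by
    simp [ENNReal.rpow_eq_zero_iff]), ENNReal.top_mul] at h1
  · exact h1 rfl
  · refine (lt_of_lt_of_le one_pos ?_).ne'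
    calc (1 : ℝ≥0∞) = ∫⁻ _, 1 ∂(κ k (x k)) := by simp
      _ ≤ _ := lintegral_mono fun y => by
        rw [← ENNReal.ofReal_one]
        exact ENNReal.ofReal_le_ofReal (Real.one_le_rpow (hV y) hα.le)

/-- If `L < ∞`, there are constants of geometric ergodicity with `C / (1 - ρ) ≤ 4 L²`. -/
lemma exists_geometricallyErgodic [IsMarkovKernel κ] (hVm : Measurable V) (hV : ∀ y, 1 ≤ V y)
    (hκ : GeometricDriftMinorization V κ) (hL : ergodicityL V κ ≠ ∞) :
    ∃ C ρ, GeometricallyErgodic V κ C ρ ∧ C / (1 - ρ) ≤ 4 * (ergodicityL V κ).toReal ^ 2 := by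
  have hL1 := one_le_toReal_ergodicityL hL
  set L := (ergodicityL V κ).toReal with hLdef
  -- The infimum need not be attained; `L ≥ 1` leaves room for constants below `2 L`, whence the
  -- bound `4 L²`.
  have hlt : ergodicityL V κ < ENNReal.ofReal (2 * L) := by
    rw [ENNReal.lt_ofReal_iff_toReal_lt hL]
    linarith
  simp only [ergodicityL, iInf_lt_iff] at hlt
  obtain ⟨C, ρ, h, hlt⟩ := hlt
  rw [ENNReal.ofReal_lt_ofReal_iff (by linarith)] at hlt
  obtain ⟨b, δ, lam, ν, -, -, -, hd, -⟩ := hκ.2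
  refine ⟨C, ρ, ⟨hVm, hV, integrable_pow_of_drift hVm hV hd, h⟩, ?_⟩
  have h1 : C ≤ 2 * L := (le_max_left _ _).trans hlt.le
  have h2 : (1 - ρ)⁻¹ ≤ 2 * L := (le_max_right _ _).trans hlt.le
  rw [div_eq_mul_inv]
  calc C * (1 - ρ)⁻¹ ≤ (2 * L) * (2 * L) :=
        mul_le_mul h1 h2 (inv_nonneg.2 (by linarith [h.2.1.2])) (by linarith)
    _ = 4 * L ^ 2 := by ring

/-- Variation of the Poisson solution in the kernel and the function. -/
lemma abs_poisson_sub_le [IsMarkovKernel κ] [IsMarkovKernel η] [Nonempty X] (hVm : Measurable V)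
    (hV : ∀ y, 1 ≤ V y) (hκ : GeometricDriftMinorization V κ) (hη : GeometricDriftMinorization V η)
    (hLκ : ergodicityL V κ ≠ ∞) (hLη : ergodicityL V η ≠ ∞) {f g : X → ℝ} {M D N B : ℝ}
    (hM : 0 ≤ M) (hf : Measurable f) (hfV : ∀ y, |f y| ≤ M * V y) (hg : Measurable g)
    (hgV : ∀ y, |g y| ≤ M * V y) (hD : 0 ≤ D) (hκη : kernelVariation V κ η ≤ ENNReal.ofReal D)
    (hN : 0 ≤ N) (hfg : ∀ y, |f y - g y| ≤ N * V y)
    (hB : ∫ y, V y ∂(invariantProb κ) ≤ B) (x : X) :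
    |poisson κ f x - poisson η g x| ≤
      16 * M * (1 + B) *
        (max (ergodicityL V κ).toReal (ergodicityL V η).toReal ^ 6 * D * V x) +
      4 * ((ergodicityL V η).toReal ^ 2 * N * V x) := by
  obtain ⟨C, ρ, h, hC⟩ := exists_geometricallyErgodic hVm hV hκ hLκ
  obtain ⟨C', ρ', h', hC'⟩ := exists_geometricallyErgodic hVm hV hη hLη
  have hL1 := one_le_toReal_ergodicityL hLκ
  have hL1' := one_le_toReal_ergodicityL hLη
  set L := (ergodicityL V κ).toReal
  set L' := (ergodicityL V η).toReal
  set ℓ := max L L'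
  have hℓ1 : 1 ≤ ℓ := hL1.trans (le_max_left _ _)
  have hVx := hV x
  have hVx0 : 0 ≤ V x := by linarith
  have hc := h.const_nonneg
  have hc' := h'.const_nonneg
  have hcℓ : C / (1 - ρ) ≤ 4 * ℓ ^ 2 := hC.trans (by
    have : L ≤ ℓ := le_max_left _ _
    gcongr)
  have hcℓ' : C' / (1 - ρ') ≤ 4 * ℓ ^ 2 := hC'.trans (by
    have : L' ≤ ℓ := le_max_right _ _
    gcongr)
  have hB0 : 0 ≤ B := le_trans (integral_nonneg fun y => by
    simp only [Pi.zero_apply]; linarith [hV y]) hB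
  have h1 := h.abs_poisson_sub_poisson_le h' hM hD hκη hf hfV x
  have h2 := h'.abs_poisson_le hN (hf.sub hg) hfg x
  have h3 : poisson η (f - g) x = poisson η f x - poisson η g x :=
    h'.poisson_sub hM hf hfV hg hgV x
  rw [h3] at h2
  have h4 : M * D * (C' / (1 - ρ')) *
      (C / (1 - ρ) * V x + C' / (1 - ρ') * ∫ y, V y ∂(invariantProb κ)) ≤
      M * D * (4 * ℓ ^ 2) * (4 * ℓ ^ 2 * V x + 4 * ℓ ^ 2 * (B * V x)) := by
    have hBV : ∫ y, V y ∂(invariantProb κ) ≤ B * V x := hB.trans (le_mul_of_one_le_right hB0 hVx)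
    have hI : 0 ≤ ∫ y, V y ∂(invariantProb κ) := integral_nonneg fun y => by
      simp only [Pi.zero_apply]; linarith [hV y]
    gcongr
  -- Two factors `C / (1 - ρ)` produce the fourth power; it is enlarged to the sixth to match (A4).
  have h5 : ℓ ^ 4 ≤ ℓ ^ 6 := pow_le_pow_right₀ hℓ1 (by norm_num)
  calc |poisson κ f x - poisson η g x|
      ≤ |poisson κ f x - poisson η f x| + |poisson η f x - poisson η g x| := abs_sub_le _ _ _
    _ ≤ M * D * (4 * ℓ ^ 2) * (4 * ℓ ^ 2 * V x + 4 * ℓ ^ 2 * (B * V x)) +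
        N * (4 * L' ^ 2) * V x := by
      refine add_le_add (h1.trans h4) (h2.trans ?_)
      gcongr
    _ = 16 * M * (1 + B) * (ℓ ^ 4 * D * V x) + 4 * (L' ^ 2 * N * V x) := by ring
    _ ≤ _ := by gcongr

variable {Θ Ω : Type*} [MeasurableSpace Θ] {mΩ : MeasurableSpace Ω}
  {P : Θ → Kernel X X} [∀ t, IsMarkovKernel (P t)] {μ : Measure Ω} [IsProbabilityMeasure μ]
  {ℱ : Filtration ℕ mΩ} {x : ℕ → Ω → X} {θ : ℕ → Ω → Θ}

/-- The averages of `F + K V`, centred by their means under the invariant measures, tend to zero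
if `|F| ≤ K V`. -/
theorem ae_tendsto_average_add_mul (hP : Measurable fun p : Θ × X => P p.1 p.2)
    (hx : ∀ n, Measurable[ℱ n] (x n)) (hθ : ∀ n, Measurable[ℱ n] (θ n))
    (hMarkov : ∀ (n : ℕ) (f : X → ℝ), Measurable f → (∃ M : ℝ, ∀ y, |f y| ≤ M) →
      μ[fun ω => f (x (n + 1) ω) | ℱ n] =ᵐ[μ] fun ω => ∫ y, f y ∂(P (θ n ω) (x n ω)))
    (hVm : Measurable V) (hV : ∀ y, 1 ≤ V y) (hA3 : ∀ t, GeometricDriftMinorization V (P t))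
    (hA4 : ∀ᵐ ω ∂μ, (∑' k : ℕ, ((k + 1 : ℕ) : ℝ≥0∞)⁻¹ *
      (max (ergodicityL V (P (θ (k + 1) ω))) (ergodicityL V (P (θ k ω)))) ^ 6 *
      kernelVariation V (P (θ (k + 1) ω)) (P (θ k ω)) *
      ENNReal.ofReal (V (x (k + 1) ω))) < ∞)
    (hA5a : ∀ᵐ ω ∂μ, limsup (fun n =>
      ∫⁻ y, ENNReal.ofReal (V y) ∂(invariantProb (P (θ n ω)))) atTop < ∞)
    {α : ℝ} (hα : 1 < α)
    (hA5b : ∀ᵐ ω ∂μ, (∑' k : ℕ, ((k + 1 : ℕ) : ℝ≥0∞) ^ (-α) *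
      ergodicityL V (P (θ k ω)) ^ (2 * α) *
      ∫⁻ y, ENNReal.ofReal (V y ^ α) ∂(P (θ k ω) (x k ω))) < ∞)
    {F : X → Θ → ℝ} (hF : Measurable fun p : X × Θ => F p.1 p.2) {K : ℝ} (hK : 0 ≤ K)
    (hFV : ∀ y t, |F y t| ≤ K * V y)
    (hFvar : ∀ᵐ ω ∂μ, (∑' k : ℕ, ((k + 1 : ℕ) : ℝ≥0∞)⁻¹ *
      ergodicityL V (P (θ k ω)) ^ 2 *
      vNorm V (fun y => F y (θ (k + 1) ω) - F y (θ k ω)) *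
      ENNReal.ofReal (V (x (k + 1) ω))) < ∞) :
    ∀ᵐ ω ∂μ, Tendsto (fun n : ℕ => (n : ℝ)⁻¹ * ∑ k ∈ Finset.range n,
      (F (x k ω) (θ k ω) + K * V (x k ω) -
        ∫ y, (F y (θ k ω) + K * V y) ∂(invariantProb (P (θ k ω))))) atTop (𝓝 0) := by
  have hα0 : 0 < α := by linarith
  obtain ⟨ω₀⟩ : Nonempty Ω := nonempty_of_isProbabilityMeasure μ
  have hne : Nonempty X := ⟨x 0 ω₀⟩
  have hV0 (y : X) : 0 < V y := lt_of_lt_of_le one_pos (hV y)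
  let G (y : X) (t : Θ) : ℝ := F y t + K * V y
  have hG : Measurable fun p : X × Θ => G p.1 p.2 :=
    hF.add ((hVm.comp measurable_fst).const_mul K)
  have hG0 (y : X) (t : Θ) : 0 ≤ G y t := by
    have := (abs_le.1 (hFV y t)).1
    simp only [G]; linarith
  have hGV (y : X) (t : Θ) : |G y t| ≤ 2 * K * V y := by
    rw [abs_of_nonneg (hG0 y t)]
    have := (abs_le.1 (hFV y t)).2
    simp only [G]; linarith
  have hM : 0 ≤ 2 * K := by positivity
  have hGt (t : Θ) : Measurable fun y => G y t := hG.comp measurable_prodMk_right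
  obtain ⟨H, p, hH, hp, hHp⟩ := exists_measurable_poisson hP hM hG hGV
  have hLfin : ∀ᵐ ω ∂μ, ∀ k, ergodicityL V (P (θ k ω)) ≠ ∞ := by
    filter_upwards [hA5b] with ω hω k
    exact ergodicityL_ne_top_of_tsum hα0 hV hω k
  have hπB : ∀ᵐ ω ∂μ, ∃ B : ℝ, ∀ k, ∫ y, V y ∂(invariantProb (P (θ k ω))) ≤ B := by
    filter_upwards [hA5a, hLfin] with ω h1 h2
    obtain ⟨c, hc1, hc2⟩ := exists_between h1
    have hev := eventually_lt_of_limsup_lt hc1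
    have hev' : ∀ᶠ k in atTop, ∫ y, V y ∂(invariantProb (P (θ k ω))) ≤ c.toReal := by
      filter_upwards [hev] with k hk
      rw [integral_eq_lintegral_of_nonneg_ae (Eventually.of_forall fun y => (hV0 y).le)
        hVm.aestronglyMeasurable]
      exact ENNReal.toReal_mono hc2.ne hk.le
    obtain ⟨B, hB⟩ := (isBoundedUnder_of_eventually_le hev').bddAbove_range
    exact ⟨B, fun k => hB ⟨k, rfl⟩⟩
  have hmean : ∀ᵐ ω ∂μ, ∀ k, p (θ k ω) = ∫ y, G y (θ k ω) ∂(invariantProb (P (θ k ω))) := by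
    filter_upwards [hLfin] with ω h1 k
    obtain ⟨C, ρ, h, -⟩ := exists_geometricallyErgodic hVm hV (hA3 (θ k ω)) (h1 k)
    exact (hHp _ C ρ h).2
  have key := ae_tendsto_average_of_poisson hP hx hθ hMarkov
    (g := fun q => G q.2 q.1) (H := H) (p := p) (W := fun y => 2 * K * V y)
    (hG.comp measurable_swap) hH hp (hVm.const_mul _) (fun q => hG0 q.2 q.1)
    (fun q => (le_abs_self _).trans (hGV q.2 q.1))
    (by
      filter_upwards [hmean] with ω h1 k
      rw [h1 k]
      exact integral_nonneg fun y => hG0 y _)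
    (by
      filter_upwards [hmean, hπB, hLfin] with ω h1 ⟨B, hB⟩ h2
      refine ⟨2 * K * B, fun k => ?_⟩
      obtain ⟨C, ρ, h, -⟩ := exists_geometricallyErgodic hVm hV (hA3 (θ k ω)) (h2 k)
      have hVi := h.integrable_invariantProb
      rw [h1 k]
      calc _ ≤ ∫ y, 2 * K * V y ∂(invariantProb (P (θ k ω))) :=
            integral_mono (integrable_of_abs_le_mul hVi (hGt _) (hGV · _)) (hVi.const_mul _)
              fun y => (le_abs_self _).trans (hGV y _)
        _ ≤ _ := by
            rw [integral_const_mul]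
            exact mul_le_mul_of_nonneg_left (hB k) hM)
    (by
      filter_upwards [hLfin] with ω h1 k
      obtain ⟨C, ρ, h, -⟩ := exists_geometricallyErgodic hVm hV (hA3 (θ k ω)) (h1 k)
      have h2 := hHp _ C ρ h
      simp only [h2.1, h2.2]
      exact (h.poisson_sub_integral hM (hGt _) (hGV · _) _).symm)
    hα
    (by
      filter_upwards [hA5b, hLfin] with ω h1 h2
      -- With `M = 2 K` and `C / (1 - ρ) ≤ 4 L²`, the Poisson solution is at most `8 K L² V`; adding
      -- `2 K V` gives the constant `10 K`.
      refine lt_of_le_of_lt (ENNReal.tsum_le_tsum (g := fun k : ℕ =>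
        ENNReal.ofReal (10 * K) ^ α * (((k + 1 : ℕ) : ℝ≥0∞) ^ (-α) *
        ergodicityL V (P (θ k ω)) ^ (2 * α) *
        ∫⁻ y, ENNReal.ofReal (V y ^ α) ∂(P (θ k ω) (x k ω)))) fun k => ?_) ?_
      · obtain ⟨C, ρ, h, hC⟩ := exists_geometricallyErgodic hVm hV (hA3 (θ k ω)) (h2 k)
        have hL1 := one_le_toReal_ergodicityL (h2 k)
        have hb (y : X) : ‖|H (θ k ω, y)| + 2 * K * V y‖ₑ ^ α ≤
            ENNReal.ofReal (10 * K) ^ α * ergodicityL V (P (θ k ω)) ^ (2 * α) *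
              ENNReal.ofReal (V y ^ α) := by
          have hVy := hV0 y
          have h3 : |H (θ k ω, y)| + 2 * K * V y ≤
              10 * K * ((ergodicityL V (P (θ k ω))).toReal ^ 2 * V y) := by
            have h4 := h.abs_poisson_le hM (hGt (θ k ω)) (hGV · _) y
            rw [← (hHp _ C ρ h).1] at h4
            have h5 : 2 * K * (C / (1 - ρ)) * V y ≤
                2 * K * (4 * (ergodicityL V (P (θ k ω))).toReal ^ 2) * V y := by gcongr
            have h6 : 1 ≤ (ergodicityL V (P (θ k ω))).toReal ^ 2 := one_le_pow₀ hL1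
            nlinarith [mul_nonneg hK hVy.le]
          rw [Real.enorm_eq_ofReal (by positivity), ENNReal.rpow_mul,
            ← ENNReal.ofReal_rpow_of_pos hVy,
            ← ENNReal.mul_rpow_of_nonneg _ _ hα0.le, ← ENNReal.mul_rpow_of_nonneg _ _ hα0.le]
          refine ENNReal.rpow_le_rpow ((ENNReal.ofReal_le_ofReal h3).trans ?_) hα0.le
          rw [ENNReal.ofReal_mul (p := 10 * K) (by positivity), ENNReal.ofReal_mul (sq_nonneg _),
            ENNReal.ofReal_pow (by positivity), ENNReal.ofReal_toReal (h2 k), mul_assoc]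
          norm_num
        calc _ ≤ ((k + 1 : ℕ) : ℝ≥0∞) ^ (-α) * ∫⁻ y, ENNReal.ofReal (10 * K) ^ α *
              ergodicityL V (P (θ k ω)) ^ (2 * α) * ENNReal.ofReal (V y ^ α)
              ∂(P (θ k ω) (x k ω)) := by
              gcongr with y
              exact hb y
          _ = _ := by
              rw [lintegral_const_mul _ (hVm.pow_const α).ennreal_ofReal]
              ring
      · rw [ENNReal.tsum_mul_left]
        exact ENNReal.mul_lt_top (ENNReal.rpow_lt_top_of_nonneg hα0.le ENNReal.ofReal_ne_top) h1)
    (by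
      filter_upwards [hA4, hFvar, hLfin, hπB] with ω h1 h2 h3 ⟨B, hB⟩
      have hs1 := ENNReal.summable_toReal h1.ne
      have hs2 := ENNReal.summable_toReal h2.ne
      refine Summable.of_nonneg_of_le (fun k => by positivity) (fun k => ?_)
        ((hs1.mul_left (16 * (2 * K) * (1 + B))).add (hs2.mul_left 4))
      have hVx := hV0 (x (k + 1) ω)
      have hVx' : ENNReal.ofReal (V (x (k + 1) ω)) ≠ 0 := by simpa using hVx
      have hk0 : ((k + 1 : ℕ) : ℝ≥0∞)⁻¹ ≠ 0 := by simp
      have hL (j : ℕ) : ergodicityL V (P (θ j ω)) ≠ 0 :=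
        (lt_of_lt_of_le one_pos one_le_ergodicityL).ne'
      have hD : kernelVariation V (P (θ (k + 1) ω)) (P (θ k ω)) ≠ ∞ := by
        intro htop
        have h4 := ENNReal.ne_top_of_tsum_ne_top h1.ne k
        rw [htop, ENNReal.mul_top, ENNReal.top_mul hVx'] at h4
        · exact h4 rfl
        · exact mul_ne_zero hk0 (pow_ne_zero _ (lt_of_lt_of_le (pos_iff_ne_zero.2 (hL k))
            (le_max_right _ _)).ne')
      have hN : vNorm V (fun y => F y (θ (k + 1) ω) - F y (θ k ω)) ≠ ∞ := by
        intro htop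
        have h4 := ENNReal.ne_top_of_tsum_ne_top h2.ne k
        rw [htop, ENNReal.mul_top, ENNReal.top_mul hVx'] at h4
        · exact h4 rfl
        · exact mul_ne_zero hk0 (pow_ne_zero _ (hL k))
      obtain ⟨C, ρ, h, -⟩ := exists_geometricallyErgodic hVm hV (hA3 (θ k ω)) (h3 k)
      obtain ⟨C', ρ', h', -⟩ := exists_geometricallyErgodic hVm hV (hA3 (θ (k + 1) ω)) (h3 (k + 1))
      rw [(hHp _ C ρ h).1, (hHp _ C' ρ' h').1]
      have h5 := abs_poisson_sub_le hVm hV (hA3 (θ (k + 1) ω)) (hA3 (θ k ω)) (h3 (k + 1)) (h3 k)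
        hM (hGt (θ (k + 1) ω)) (hGV · _) (hGt (θ k ω)) (hGV · _) ENNReal.toReal_nonneg
        (ENNReal.ofReal_toReal hD).ge ENNReal.toReal_nonneg (fun y => by
          have := abs_le_of_vNorm_le ENNReal.toReal_nonneg hV (ENNReal.ofReal_toReal hN).ge y
          simpa [G] using this) (hB (k + 1)) (x (k + 1) ω)
      refine (div_le_div_of_nonneg_right h5 (by positivity)).trans (le_of_eq ?_)
      simp only [ENNReal.toReal_mul, ENNReal.toReal_pow, ENNReal.toReal_inv, ENNReal.toReal_natCast,
        ENNReal.toReal_ofReal hVx.le, ENNReal.toReal_max (h3 (k + 1)) (h3 k)]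
      push_cast
      field_simp)
  filter_upwards [key, hmean] with ω h1 h2
  simp only [h2] at h1
  exact h1

end Main

end AdaptiveMCMC

/-! ### The law of large numbers. -/

open AdaptiveMCMC in
theorem theorem2p7
    {X Θ Ω : Type*} [MeasurableSpace X] [MeasurableSpace Θ] [mΩ : MeasurableSpace Ω]
    -- the family of Markov transition kernels
    (P : Θ → Kernel X X) [∀ θ, IsMarkovKernel (P θ)]
    (hP : Measurable fun p : Θ × X => P p.1 p.2)
    -- the adapted process
    (μ : Measure Ω) [IsProbabilityMeasure μ] (ℱ : Filtration ℕ mΩ)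
    (x : ℕ → Ω → X) (θ : ℕ → Ω → Θ)
    (hx : ∀ n, Measurable[ℱ n] (x n)) (hθ : ∀ n, Measurable[ℱ n] (θ n))
    (hMarkov : ∀ (n : ℕ) (f : X → ℝ), Measurable f → (∃ M : ℝ, ∀ y, |f y| ≤ M) →
      μ[fun ω => f (x (n + 1) ω) | ℱ n] =ᵐ[μ] fun ω => ∫ y, f y ∂(P (θ n ω) (x n ω)))
    -- drift and minorization
    (V : X → ℝ) (hVmeas : Measurable V) (hV : ∀ y, 1 ≤ V y)
    (hA3 : ∀ t, AdaptiveMCMC.GeometricDriftMinorization V (P t))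
    -- diminishing adaptation
    (hA4 : ∀ᵐ ω ∂μ, (∑' k : ℕ, ((k + 1 : ℕ) : ℝ≥0∞)⁻¹ *
      (max (AdaptiveMCMC.ergodicityL V (P (θ (k + 1) ω)))
        (AdaptiveMCMC.ergodicityL V (P (θ k ω)))) ^ 6 *
      AdaptiveMCMC.kernelVariation V (P (θ (k + 1) ω)) (P (θ k ω)) *
      ENNReal.ofReal (V (x (k + 1) ω))) < ∞)
    -- moment conditions
    (hA5a : ∀ᵐ ω ∂μ, limsup (fun n =>
      ∫⁻ y, ENNReal.ofReal (V y) ∂(AdaptiveMCMC.invariantProb (P (θ n ω)))) atTop < ∞)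
    (hA5b : ∃ α : ℝ, 1 < α ∧ ∀ᵐ ω ∂μ, (∑' k : ℕ, ((k + 1 : ℕ) : ℝ≥0∞) ^ (-α) *
      AdaptiveMCMC.ergodicityL V (P (θ k ω)) ^ (2 * α) *
      ∫⁻ y, ENNReal.ofReal (V y ^ α) ∂(P (θ k ω) (x k ω))) < ∞)
    -- the function
    (F : X → Θ → ℝ) (hF : Measurable fun p : X × Θ => F p.1 p.2)
    (hFnorm : (⨆ t, AdaptiveMCMC.vNorm V (fun y => F y t)) < ∞)
    (hFvar : ∀ᵐ ω ∂μ, (∑' k : ℕ, ((k + 1 : ℕ) : ℝ≥0∞)⁻¹ *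
      AdaptiveMCMC.ergodicityL V (P (θ k ω)) ^ 2 *
      AdaptiveMCMC.vNorm V (fun y => F y (θ (k + 1) ω) - F y (θ k ω)) *
      ENNReal.ofReal (V (x (k + 1) ω))) < ∞)
    (hFlim : ∀ᵐ ω ∂μ, ∃ ℓ : ℝ, Tendsto (fun n =>
      ∫ y, F y (θ n ω) ∂(AdaptiveMCMC.invariantProb (P (θ n ω)))) atTop (𝓝 ℓ)) :
    ∀ᵐ ω ∂μ, ∃ ℓ : ℝ,
      Tendsto (fun n => ∫ y, F y (θ n ω) ∂(AdaptiveMCMC.invariantProb (P (θ n ω)))) atTop (𝓝 ℓ) ∧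
      Tendsto (fun n : ℕ => (n : ℝ)⁻¹ * ∑ k ∈ Finset.range n, F (x k ω) (θ k ω)) atTop (𝓝 ℓ) := by
  obtain ⟨α, hα, hA5b⟩ := hA5b
  obtain ⟨ω₀⟩ : Nonempty Ω := nonempty_of_isProbabilityMeasure μ
  have hne : Nonempty X := ⟨x 0 ω₀⟩
  set K := (⨆ t, vNorm V (fun y => F y t)).toReal with hKdef
  have hK : 0 ≤ K := ENNReal.toReal_nonneg
  have hFV (y : X) (t : Θ) : |F y t| ≤ K * V y := by
    refine abs_le_of_vNorm_le (f := fun y => F y t) hK hV ?_ y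
    rw [hKdef, ENNReal.ofReal_toReal hFnorm.ne]
    exact le_iSup (fun t => vNorm V (fun y => F y t)) t
  -- The result for `F + K V` minus the one for `K V` (the case `F = 0`) gives the centred averages
  -- of `F`; the Cesàro means of `π_{θ_k} F` supply the limit.
  have h1 := ae_tendsto_average_add_mul hP hx hθ hMarkov hVmeas hV hA3 hA4 hA5a hα hA5b hF hK hFV
    hFvar
  have h2 := ae_tendsto_average_add_mul hP hx hθ hMarkov hVmeas hV hA3 hA4 hA5a hα hA5b
    (F := fun _ _ => 0) measurable_const hK
    (fun y t => by simpa using mul_nonneg hK (zero_le_one.trans (hV y)))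
    (Eventually.of_forall fun ω => by simp [vNorm])
  have hLfin : ∀ᵐ ω ∂μ, ∀ k, ergodicityL V (P (θ k ω)) ≠ ∞ := by
    filter_upwards [hA5b] with ω hω k
    exact ergodicityL_ne_top_of_tsum (by linarith) hV hω k
  filter_upwards [h1, h2, hLfin, hFlim] with ω h1 h2 hL ⟨ℓ, hℓ⟩
  refine ⟨ℓ, hℓ, ?_⟩
  have h3 := (h1.sub h2).add hℓ.cesaro
  rw [sub_self, zero_add] at h3
  refine h3.congr fun n => ?_
  rw [← mul_sub, ← mul_add, ← Finset.sum_sub_distrib, ← Finset.sum_add_distrib]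
  congr 1
  refine Finset.sum_congr rfl fun k _ => ?_
  obtain ⟨C, ρ, h, -⟩ := exists_geometricallyErgodic hVmeas hV (hA3 (θ k ω)) (hL k)
  have hVi := h.integrable_invariantProb
  have hFi : Integrable (fun y => F y (θ k ω)) (invariantProb (P (θ k ω))) :=
    integrable_of_abs_le_mul hVi (hF.comp measurable_prodMk_right) (hFV · _)
  rw [integral_add hFi (hVi.const_mul K)]
  simp only [zero_add]
  ring
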